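/- Let $G$ be a discrete group. Categories are small; a $G$-category is a category with a strict left action of $G$ by automorphisms. For a set $X$ let $\mathcal{E}X$ be the chaotic category on $X$ (one morphism between any two objects), and let $G$ act on $\mathcal{E}G$ by left multiplication. For a $G$-category $\mathcal{A}$ let $\mathbf{Cat}(\mathcal{E}G,\mathcal{A})$ be the $G$-category of all functors $\mathcal{E}G\to\mathcal{A}$ and all natural transformations, with $G$ acting by conjugation, and let $\iota\colon\mathcal{A}\to\mathbf{Cat}(\mathcal{E}G,\mathcal{A})$ be the $G$-functor sending an object to the constant functor at it. Let $\mathcal{P}$ be the permutativity operad, $\mathcal{P}(n)=\mathcal{E}\Sigma_n$, with structure induced from the associativity operad and with trivial $G$-action, and let $\mathcal{P}_G=\mathbf{Cat}(\mathcal{E}G,\mathcal{P})$ be the operad in $G$-categories with the induced structure; $\iota$ gives a map of $G$-operads $\mathcal{P}\to\mathcal{P}_G$. For a reduced operad $\mathcal{O}$ in $G$-categories, an $\mathcal{O}$-pseudoalgebra is a $G$-category $\mathcal{A}$ with $G$-functors $\theta_n\colon\mathcal{O}(n)\times\mathcal{A}^n\to\mathcal{A}$ and invertible $G$-transformations $\varphi\colon\theta_n(a;\theta_{m_1}(b_1;x_1),\dots,\theta_{m_n}(b_n;x_n))\Rightarrow\theta_m(\gamma(a;b_1,\dots,b_n);x_1,\dots,x_n)$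 ($m=m_1+\dots+m_n$) such that $\theta$ is equivariant under the symmetric groups and $\theta_1(1;-)=\mathrm{id}$, and $\varphi$ is equivariant under the symmetric groups, is the identity at $(1;b)$, at $(a;1,\dots,1)$ and at $(a;1,\dots,1,0,1,\dots,1)$, and is associative with respect to $\gamma$. It is a (strict) $\mathcal{O}$-algebra if all $\varphi$ are identities. An $\mathcal{O}$-pseudomorphism is a $G$-functor $f$ with invertible $G$-transformations $\zeta_n\colon\theta_n(a;f x_1,\dots,f x_n)\Rightarrow f\theta_n(a;x_1,\dots,x_n)$ that are equivariant under the symmetric groups, compatible with $\varphi$, and the identity for $n=0$ and at the operadic identity $1$; it is a strict map if all $\zeta_n$ are identities. Naive (respectively genuine) symmetric monoidal $G$-categories are the $\mathcal{P}$-pseudoalgebras (respectively $\mathcal{P}_G$-pseudoalgebras) in $G$-categories, with pseudomorphisms as morphisms; naive (respectively genuine) permutative $G$-categories are the strict $\mathcal{P}$-algebras (respectively strict $\mathcal{P}_G$-algebras), with strict maps as morphisms. **Proposition.** The functor $\mathbf{Cat}(\mathcal{E}G,-)$ induces, by applying all structure pointwise, a functor from naive to genuine symmetric monoidal $G$-categories,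 and it restricts to a functor from naive to genuine permutative $G$-categories: for each naive $\mathcal{A}$, the $G$-category $\mathbf{Cat}(\mathcal{E}G,\mathcal{A})$ carries the genuine structure with action functors $\mathcal{P}_G(n)\times\mathbf{Cat}(\mathcal{E}G,\mathcal{A})^n\cong\mathbf{Cat}(\mathcal{E}G,\mathcal{P}(n)\times\mathcal{A}^n)\to\mathbf{Cat}(\mathcal{E}G,\mathcal{A})$ and with $\varphi$ given pointwise, and each morphism $f$ induces $\mathbf{Cat}(\mathcal{E}G,f)$ with $\zeta$ given pointwise. In both cases $\iota\colon\mathcal{A}\to\mathbf{Cat}(\mathcal{E}G,\mathcal{A})$ is natural in $\mathcal{A}$, is a strict map of naive structures, where the target is viewed as a naive structure by restriction along $\mathcal{P}\to\mathcal{P}_G$, and is a naive equivalence: after forgetting the action of $G$, it is an equivalence in the $2$-category of $\mathcal{P}$-pseudoalgebras, pseudomorphisms and algebra $2$-cells (respectively, for permutative $G$-categories, of strict $\mathcal{P}$-algebras, strict maps and algebra $2$-cells). -/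

import Mathlib

open CategoryTheory

universe w' w v u

namespace OperadicGCat

section Blocks

variable {n k : ℕ} {m : Fin n → ℕ}

/-- The identification of the disjoint union of blocks of sizes `m 0, …, m (n - 1)`, in this
order, with `Fin k`, where `k = m 0 + ⋯ + m (n - 1)`. -/
def block (h : ∑ i, m i = k) : (Σ i : Fin n, Fin (m i)) ≃ Fin k :=
  finSigmaFinEquiv.trans (finCongr h)

/-- The inclusion of the `i`-th block. -/
def inc (h : ∑ i, m i = k) (i : Fin n) (s : Fin (m i)) : Fin k :=
  block h ⟨i, s⟩

/-- The block sum `τ₁ ⊕ ⋯ ⊕ τₙ`. -/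
def blockSum (h : ∑ i, m i = k) (τ : ∀ i, Equiv.Perm (Fin (m i))) : Equiv.Perm (Fin k) :=
  (block h).symm.trans ((Equiv.sigmaCongrRight τ).trans (block h))

/-- The permutation that permutes `n` blocks as `σ` permutes `n` letters: the `i`-th block, which
has size `m (σ i)`, is moved to position `σ i`. -/
def blockPerm (σ : Equiv.Perm (Fin n)) (h' : ∑ i, m (σ i) = k) (h : ∑ i, m i = k) :
    Equiv.Perm (Fin k) :=
  (block h').symm.trans ((Equiv.sigmaCongrLeft (β := fun i => Fin (m i)) σ).trans (block h))

/-- The composition of the associativity operad,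
`γ(σ; τ₁, …, τₙ) = σ(m₁, …, mₙ) (τ₁ ⊕ ⋯ ⊕ τₙ)`. -/
def assocComp (h : ∑ i, m i = k) (σ : Equiv.Perm (Fin n)) (τ : ∀ i, Equiv.Perm (Fin (m i))) :
    Equiv.Perm (Fin k) :=
  (blockSum h τ).trans ((block h).symm.trans ((Equiv.sigmaCongrLeft' σ).trans
    (block (((Equiv.sum_comp σ.symm m).trans h : ∑ i, m (σ.symm i) = k)))))

theorem block_symm_inc (h : ∑ i, m i = k) (i : Fin n) (s : Fin (m i)) :
    (block h).symm (inc h i s) = ⟨i, s⟩ := by simp [inc]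

theorem inc_surj (h : ∑ i, m i = k) (x : Fin k) : ∃ i s, x = inc h i s :=
  ⟨((block h).symm x).1, ((block h).symm x).2, by simp [inc]⟩

theorem inc_val (h : ∑ i, m i = k) (i : Fin n) (s : Fin (m i)) :
    (inc h i s : ℕ) = (∑ j, if j < i then m j else 0) + s := by
  simp only [inc, block, Equiv.trans_apply, finCongr_apply, Fin.val_cast, finSigmaFinEquiv_apply,
    add_left_inj]
  rw [← Finset.sum_filter]
  refine Finset.sum_bij (fun j _ => Fin.castLE i.2.le j) ?_ ?_ ?_ ?_
  · intro a _; exact Finset.mem_filter.2 ⟨Finset.mem_univ _, a.2⟩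
  · intro a _ b _ hab; simpa [Fin.ext_iff] using hab
  · intro b hb
    simp only [Finset.mem_filter, Finset.mem_univ, true_and] at hb
    exact ⟨⟨b, hb⟩, Finset.mem_univ _, rfl⟩
  · intro a _; rfl

theorem inc_lt_inc_iff (h : ∑ i, m i = k) (i i' : Fin n) (s : Fin (m i)) (s' : Fin (m i')) :
    inc h i s < inc h i' s' ↔ i < i' ∨ (i = i' ∧ (s : ℕ) < s') := by
  have key : ∀ (a b : Fin n) (x : Fin (m a)) (y : Fin (m b)), a < b → inc h a x < inc h b y := by
    intro a b x y hab
    rw [Fin.lt_def, inc_val, inc_val]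
    have h1 : (∑ j, if j < a then m j else 0) + m a ≤ ∑ j, if j < b then m j else 0 := by
      have : (∑ j, if j < a then m j else 0) + m a
          = ∑ j, ((if j < a then m j else 0) + if j = a then m j else 0) := by
        rw [Finset.sum_add_distrib]; simp
      rw [this]
      refine Finset.sum_le_sum fun j _ => ?_
      rcases lt_trichotomy j a with hj | hj | hj
      · simp [hj, hj.ne, hj.trans hab]
      · simp [hj, hab]
      · simp [hj.not_gt, hj.ne']
    have := x.2
    omega
  rcases lt_trichotomy i i' with hi | hi | hi
  · simp [hi, key _ _ s s' hi]
  · subst hi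
    rw [Fin.lt_def, inc_val, inc_val]
    simp
  · simp [hi.not_gt, hi.ne', (key _ _ s' s hi).le]

/-- Blocks of blocks. -/
theorem inc_inc {M P : ℕ} {p : Fin M → ℕ} {q : Fin n → ℕ} (hM : ∑ i, m i = M)
    (hP : ∑ j, p j = P) (hq : ∀ i, ∑ s, p (inc hM i s) = q i) (hQ : ∑ i, q i = P)
    (i : Fin n) (s : Fin (m i)) (t : Fin (p (inc hM i s))) :
    inc hQ i (inc (hq i) s t) = inc hP (inc hM i s) t := by
  apply Fin.ext
  rw [inc_val, inc_val, inc_val, ← add_assoc]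
  congr 1
  rw [← Equiv.sum_comp (block hM) (fun j => if j < inc hM i s then p j else 0),
    Fintype.sum_sigma]
  have e : ∀ i', (∑ s', if block hM ⟨i', s'⟩ < inc hM i s then p (block hM ⟨i', s'⟩) else 0)
      = (if i' < i then q i' else 0) +
        if i' = i then ∑ s', (if s' < s then p (inc hM i s') else 0) else 0 := by
    intro i'
    change (∑ s', if inc hM i' s' < inc hM i s then p (inc hM i' s') else 0) = _
    simp only [inc_lt_inc_iff]
    rcases lt_trichotomy i' i with hi | hi | hi
    · simp [hi, hi.ne, hq]
    · subst hi; simp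
    · simp [hi.not_gt, hi.ne']
  rw [Finset.sum_congr rfl fun i' _ => e i', Finset.sum_add_distrib]
  simp

theorem blockSum_inc (h : ∑ i, m i = k) (τ : ∀ i, Equiv.Perm (Fin (m i))) (i : Fin n)
    (s : Fin (m i)) : blockSum h τ (inc h i s) = inc h i (τ i s) := by
  simp [blockSum, inc]

theorem blockPerm_inc (σ : Equiv.Perm (Fin n)) (h' : ∑ i, m (σ i) = k) (h : ∑ i, m i = k)
    (i : Fin n) (s : Fin (m (σ i))) :
    blockPerm σ h' h (inc (m := fun i => m (σ i)) h' i s) = inc h (σ i) s := by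
  simp only [blockPerm, Equiv.trans_apply, block_symm_inc]
  rfl

theorem assocComp_symm_inc (h : ∑ i, m i = k) (σ : Equiv.Perm (Fin n))
    (τ : ∀ i, Equiv.Perm (Fin (m i))) (h' : ∑ i, m (σ.symm i) = k) (i : Fin n)
    (s : Fin (m (σ.symm i))) :
    (assocComp h σ τ).symm (inc (m := fun i => m (σ.symm i)) h' i s) =
      inc h (σ.symm i) ((τ (σ.symm i)).symm s) := by
  rw [Equiv.symm_apply_eq]
  simp only [assocComp, Equiv.trans_apply, blockSum_inc, block_symm_inc, Equiv.apply_symm_apply]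
  have : (Equiv.sigmaCongrLeft' (β := fun i => Fin (m i)) σ) ⟨σ.symm i, s⟩ = ⟨i, s⟩ := by
    rw [← Equiv.eq_symm_apply]; rfl
  rw [this]; rfl

theorem assocComp_one_left (h : ∑ _i : Fin 1, n = n) (a : Equiv.Perm (Fin n)) :
    assocComp (m := fun _ => n) h 1 (fun _ => a) = a := by
  have e : ∀ (i : Fin 1) (s : Fin n), inc (m := fun _ => n) h i s = s := by
    intro i s; apply Fin.ext; rw [inc_val]; simp
  rw [← Equiv.symm_bijective.injective.eq_iff]
  ext x : 1
  have := assocComp_symm_inc (m := fun _ => n) h 1 (fun _ => a) h 0 x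
  rwa [e, e] at this

theorem assocComp_one_right (h : ∑ _i : Fin n, 1 = n) (a : Equiv.Perm (Fin n)) :
    assocComp (m := fun _ => 1) h a (fun _ => 1) = a := by
  have e : ∀ (i : Fin n) (s : Fin 1), inc (m := fun _ => 1) h i s = i := by
    intro i s; apply Fin.ext; rw [inc_val]
    have : Finset.univ.filter (· < i) = Finset.Iio i := by ext; simp
    simp [this]
  rw [← Equiv.symm_bijective.injective.eq_iff]
  ext x : 1
  have := assocComp_symm_inc (m := fun _ => 1) h a (fun _ => 1) h x 0
  rwa [e, e] at this

theorem assocComp_assoc {M P : ℕ} {p : Fin M → ℕ} {q : Fin n → ℕ} (hM : ∑ i, m i = M)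
    (hP : ∑ j, p j = P) (hq : ∀ i, ∑ s, p (inc hM i s) = q i) (hQ : ∑ i, q i = P)
    (a : Equiv.Perm (Fin n)) (b : ∀ i, Equiv.Perm (Fin (m i))) (c : ∀ j, Equiv.Perm (Fin (p j))) :
    assocComp hP (assocComp hM a b) c =
      assocComp hQ a (fun i => assocComp (hq i) (b i) (fun s => c (inc hM i s))) := by
  rw [← Equiv.symm_bijective.injective.eq_iff]
  ext x : 1
  have hQ' : ∑ i, q (a.symm i) = P := (Equiv.sum_comp a.symm q).trans hQ
  have hM' : ∑ i, m (a.symm i) = M := (Equiv.sum_comp a.symm m).trans hM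
  have hP' : ∑ j, p ((assocComp hM a b).symm j) = P :=
    (Equiv.sum_comp (assocComp hM a b).symm p).trans hP
  have hq' : ∀ i, ∑ s, p (inc hM i ((b i).symm s)) = q i := fun i =>
    (Equiv.sum_comp (b i).symm fun s => p (inc hM i s)).trans (hq i)
  obtain ⟨i, y, rfl⟩ := inc_surj (m := fun i => q (a.symm i)) hQ' x
  obtain ⟨s, t, rfl⟩ := inc_surj (m := fun s => p (inc hM _ ((b _).symm s))) (hq' (a.symm i)) y
  rw [assocComp_symm_inc hQ, assocComp_symm_inc (m := fun s => p (inc hM _ s)), inc_inc hM hP hq hQ]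
  have h1 := assocComp_symm_inc hM a b hM' i s
  have h2 : ∀ i s, p ((assocComp hM a b).symm (inc (m := fun i => m (a.symm i)) hM' i s)) =
    p (inc hM (a.symm i) ((b (a.symm i)).symm s)) := fun i s => by
      rw [assocComp_symm_inc hM a b hM' i s]
  have hq'' : ∀ i, ∑ s, p ((assocComp hM a b).symm (inc (m := fun i => m (a.symm i)) hM' i s))
      = q (a.symm i) := fun i => by
    rw [← hq' (a.symm i)]; exact Finset.sum_congr rfl fun s _ => h2 i s
  have h3 := inc_inc (m := fun i => m (a.symm i)) hM' hP' hq'' hQ' i s (Fin.cast (h2 i s).symm t)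
  have h4 : inc (m := fun s => p (inc hM (a.symm i) ((b (a.symm i)).symm s))) (hq' (a.symm i)) s t
      = inc (hq'' i) s (Fin.cast (h2 i s).symm t) := by
    apply Fin.ext; simp only [inc_val, Fin.val_cast, h2]
  rw [h4, h3, assocComp_symm_inc hP]
  have : ∀ (j j' : Fin M) (hj : j = j') (e : p j' = p j) (t : Fin (p j')),
      inc hP j ((c j).symm (Fin.cast e t)) = inc hP j' ((c j').symm t) := by
    rintro j _ rfl e t; rfl
  exact this _ _ h1 _ t

theorem assocComp_act (h' : ∀ σ : Equiv.Perm (Fin n), ∑ i, m (σ i) = k) (h : ∑ i, m i = k)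
    (σ : Equiv.Perm (Fin n)) (a : Equiv.Perm (Fin n)) (b : ∀ i, Equiv.Perm (Fin (m i))) :
    assocComp (m := fun i => m (σ i)) (h' σ) (a * σ) (fun i => b (σ i)) =
      assocComp h a b * blockPerm σ (h' σ) h := by
  rw [← Equiv.symm_bijective.injective.eq_iff]
  ext x : 1
  obtain ⟨i, s, rfl⟩ := inc_surj (m := fun i => m (a.symm i)) (h' a.symm) x
  change _ = (blockPerm σ (h' σ) h).symm ((assocComp h a b).symm _)
  rw [assocComp_symm_inc h, Equiv.eq_symm_apply]
  have e : ∀ i, σ ((a * σ).symm i) = a.symm i := fun i => by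
    change σ (σ.symm (a.symm i)) = _; simp
  have h1 : inc (m := fun i => m (a.symm i)) (h' a.symm) i s =
      inc (m := fun i => m (σ ((a * σ).symm i))) (by simpa only [e] using h' a.symm) i
        (Fin.cast (by rw [e]) s) := by
    apply Fin.ext; simp only [inc_val, Fin.val_cast, e]
  rw [h1, assocComp_symm_inc (m := fun i => m (σ i)), blockPerm_inc]
  have : ∀ (j j' : Fin n) (hj : j = j') (e : m j' = m j) (t : Fin (m j')),
      inc h j ((b j).symm (Fin.cast e t)) = inc h j' ((b j').symm t) := by
    rintro j _ rfl e t; rfl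
  exact this _ _ (e i) _ s

theorem assocComp_blockSum (h : ∑ i, m i = k) (a : Equiv.Perm (Fin n))
    (b τ : ∀ i, Equiv.Perm (Fin (m i))) :
    assocComp h a (fun i => b i * τ i) = assocComp h a b * blockSum h τ := by
  ext x : 1
  obtain ⟨i, s, rfl⟩ := inc_surj h x
  simp only [assocComp, Equiv.trans_apply, Equiv.Perm.mul_apply, blockSum_inc]

end Blocks

section Operads

/-- A (strict) action of the group `G` on the category `A`; a category with such an action is a
`G`-category, that is, a category internal to `G`-sets. -/
class GAction (G : Type*) [Group G] (A : Type*) [Category A] where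
  /-- the automorphism by which `g` acts -/
  act : G → A ⥤ A
  act_one : act 1 = 𝟭 A
  act_mul : ∀ g h, act (g * h) = act h ⋙ act g

/-- A functor `X × ∏ i, Y i ⥤ Z`, written out on objects and morphisms. -/
structure ProdFunctor (X : Type*) [Category X] {ι : Type*} (Y : ι → Type*) [∀ i, Category (Y i)]
    (Z : Type*) [Category Z] where
  /-- the function on objects -/
  obj : X → (∀ i, Y i) → Z
  /-- the function on morphisms -/
  map : ∀ {a a' : X} {b b' : ∀ i, Y i} (_ : a ⟶ a') (_ : ∀ i, b i ⟶ b' i), obj a b ⟶ obj a' b'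
  map_id : ∀ (a : X) (b : ∀ i, Y i), map (𝟙 a) (fun i => 𝟙 (b i)) = 𝟙 (obj a b)
  map_comp : ∀ {a a' a'' : X} {b b' b'' : ∀ i, Y i} (f : a ⟶ a') (f' : a' ⟶ a'')
    (g : ∀ i, b i ⟶ b' i) (g' : ∀ i, b' i ⟶ b'' i),
    map (f ≫ f') (fun i => g i ≫ g' i) = map f g ≫ map f' g'

/-- A reduced operad in the category of small categories. The index `k` with `∑ i, m i = k` is the
total arity. Functors are equal if and only if they agree on morphisms; equations between functors
are stated in this form, with `Arrow.mk` recording a morphism together with its source and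
target. -/
structure Operad where
  /-- the category of `n`-ary operations -/
  obj : ℕ → Type w
  [cat : ∀ n, Category.{w'} (obj n)]
  /-- the right action of the symmetric groups -/
  act : ∀ {n : ℕ}, Equiv.Perm (Fin n) → obj n ⥤ obj n
  act_one : ∀ {n : ℕ}, act (1 : Equiv.Perm (Fin n)) = 𝟭 _
  act_mul : ∀ {n : ℕ} (σ τ : Equiv.Perm (Fin n)), act (σ * τ) = act σ ⋙ act τ
  /-- the unique object of `obj 0` -/
  zero : obj 0
  eq_zero : ∀ a : obj 0, a = zero
  hom_zero : ∀ f : zero ⟶ zero, f = 𝟙 zero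
  /-- the operadic identity -/
  one : obj 1
  /-- the operadic composition -/
  γ : ∀ {n k : ℕ} (m : Fin n → ℕ) (_ : ∑ i, m i = k),
    ProdFunctor (obj n) (fun i => obj (m i)) (obj k)
  /-- `γ(1; a) = a` -/
  one_γ : ∀ {n : ℕ} (h : ∑ _i : Fin 1, n = n) {a a' : obj n} (f : a ⟶ a'),
    Arrow.mk ((γ (fun _ => n) h).map (𝟙 one) (fun _ => f)) = Arrow.mk f
  /-- `γ(a; 1, …, 1) = a` -/
  γ_one : ∀ {n : ℕ} (h : ∑ _i : Fin n, 1 = n) {a a' : obj n} (f : a ⟶ a'),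
    Arrow.mk ((γ (fun _ => 1) h).map f (fun _ => 𝟙 one)) = Arrow.mk f
  /-- associativity; the innermost operations are indexed by the blocks of blocks -/
  γ_assoc : ∀ {n M P : ℕ} {m : Fin n → ℕ} {p : Fin M → ℕ} {q : Fin n → ℕ} (hM : ∑ i, m i = M)
    (hP : ∑ j, p j = P) (hq : ∀ i, ∑ s, p (inc hM i s) = q i) (hQ : ∑ i, q i = P)
    {a a' : obj n} {b b' : ∀ i, obj (m i)} {c c' : ∀ j, obj (p j)}
    (f : a ⟶ a') (g : ∀ i, b i ⟶ b' i) (l : ∀ j, c j ⟶ c' j),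
    Arrow.mk ((γ p hP).map ((γ m hM).map f g) l) =
    Arrow.mk ((γ q hQ).map f (fun i => (γ _ (hq i)).map (g i) (fun s => l (inc hM i s))))
  /-- `γ(a σ; b_(σ 1), …, b_(σ n)) = γ(a; b₁, …, bₙ) σ⟨m⟩`, with `σ⟨m⟩` the block permutation -/
  γ_act : ∀ {n k : ℕ} {m : Fin n → ℕ} (σ : Equiv.Perm (Fin n)) (h' : ∑ i, m (σ i) = k)
    (h : ∑ i, m i = k) {a a' : obj n} {b b' : ∀ i, obj (m i)}
    (f : a ⟶ a') (g : ∀ i, b i ⟶ b' i),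
    Arrow.mk ((γ (fun i => m (σ i)) h').map ((act σ).map f) (fun i => g (σ i))) =
    Arrow.mk ((act (blockPerm σ h' h)).map ((γ m h).map f g))
  /-- `γ(a; b₁ τ₁, …, bₙ τₙ) = γ(a; b₁, …, bₙ) (τ₁ ⊕ ⋯ ⊕ τₙ)` -/
  γ_blockSum : ∀ {n k : ℕ} {m : Fin n → ℕ} (h : ∑ i, m i = k) (τ : ∀ i, Equiv.Perm (Fin (m i)))
    {a a' : obj n} {b b' : ∀ i, obj (m i)} (f : a ⟶ a') (g : ∀ i, b i ⟶ b' i),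
    Arrow.mk ((γ m h).map f (fun i => (act (τ i)).map (g i))) =
    Arrow.mk ((act (blockSum h τ)).map ((γ m h).map f g))

attribute [instance] Operad.cat

/-- A reduced operad in the category of small `G`-categories. -/
structure GOperad (G : Type u) [Group G] extends Operad.{w', w} where
  [gact : ∀ n, GAction G (obj n)]
  gact_act : ∀ (g : G) {n : ℕ} (σ : Equiv.Perm (Fin n)),
    act σ ⋙ GAction.act g = GAction.act g ⋙ act σ
  gact_one : ∀ g : G, (GAction.act g).obj one = one
  gact_γ : ∀ (g : G) {n k : ℕ} (m : Fin n → ℕ) (h : ∑ i, m i = k) {a a' : obj n}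
    {b b' : ∀ i, obj (m i)} (f : a ⟶ a') (l : ∀ i, b i ⟶ b' i),
    Arrow.mk ((γ m h).map ((GAction.act g).map f) (fun i => (GAction.act g).map (l i))) =
    Arrow.mk ((GAction.act g).map ((γ m h).map f l))

attribute [instance] GOperad.gact

/-- The operations `0` (of arity `0`) and `1` (of arity `1`). -/
def Operad.pt (O : Operad.{w', w}) : (j : Fin 2) → O.obj j
  | 0 => O.zero
  | 1 => O.one

/-- The arities `1, …, 1, 0, 1, …, 1` with `0` in position `r`. -/
def degen {N : ℕ} (r : Fin (N + 1)) (i : Fin (N + 1)) : Fin 2 := if i = r then 0 else 1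

theorem sum_degen {N : ℕ} (r : Fin (N + 1)) : ∑ i, (degen r i : ℕ) = N := by
  have h1 : ∀ i, (degen r i : ℕ) + (if i = r then 1 else 0) = 1 := by
    intro i; unfold degen; split_ifs <;> rfl
  have h2 : ∑ i, ((degen r i : ℕ) + if i = r then 1 else 0) = N + 1 := by
    rw [Finset.sum_congr rfl fun i _ => h1 i]; simp
  rw [Finset.sum_add_distrib] at h2
  simpa using h2

end Operads

section Pseudoalgebras

/-- The morphism `f` is an identity morphism (in particular, its source and target agree). -/
def IsIdentity {C : Type*} [Category C] {X Y : C} (f : X ⟶ Y) : Prop :=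
  Arrow.mk f = Arrow.mk (𝟙 Y)

/-- The structure of a pseudoalgebra over the operad `O` on the category `A`. Transformations are
compared as functions from objects to morphisms. The identification of `A^(m₁) × ⋯ × A^(mₙ)` with
`A^k` is used to write the variables of `φ` as `(a; b₁, …, bₙ; x)` with `x` in `A^k`. -/
structure PsAlgStr (O : Operad.{w', w}) (A : Type u) [Category.{v} A] where
  /-- the action functors `O(n) × Aⁿ ⥤ A` -/
  θ : ∀ n, ProdFunctor (O.obj n) (fun _ : Fin n => A) A
  /-- the invertible composition transformations
  `θ(a; θ(b₁; x₁), …, θ(bₙ; xₙ)) ≅ θ(γ(a; b₁, …, bₙ); x)`, with `xᵢ` the `i`-th block of `x` -/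
  φ : ∀ {n k : ℕ} (m : Fin n → ℕ) (h : ∑ i, m i = k) (a : O.obj n) (b : ∀ i, O.obj (m i))
    (x : Fin k → A), (θ n).obj a (fun i => (θ (m i)).obj (b i) (fun s => x (inc h i s))) ≅
      (θ k).obj ((O.γ m h).obj a b) x
  φ_natural : ∀ {n k : ℕ} (m : Fin n → ℕ) (h : ∑ i, m i = k) {a a' : O.obj n}
    {b b' : ∀ i, O.obj (m i)} {x x' : Fin k → A} (f : a ⟶ a') (g : ∀ i, b i ⟶ b' i)
    (l : ∀ j, x j ⟶ x' j),
    (θ n).map f (fun i => (θ (m i)).map (g i) (fun s => l (inc h i s))) ≫ (φ m h a' b' x').hom =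
      (φ m h a b x).hom ≫ (θ k).map ((O.γ m h).map f g) l
  /-- equivariance of the action, `θ(a ρ; x) = θ(a; ρ x)`, where `(ρ x)ᵢ = x_(ρ⁻¹ i)` -/
  θ_act : ∀ {n : ℕ} (ρ : Equiv.Perm (Fin n)) {a a' : O.obj n} {x x' : Fin n → A} (f : a ⟶ a')
    (l : ∀ i, x i ⟶ x' i),
    Arrow.mk ((θ n).map ((O.act ρ).map f) l) =
    Arrow.mk ((θ n).map f (fun i => l (ρ.symm i)))
  /-- unit object: `φ` at the operations `(a; 1, …, 1, 0, 1, …, 1)` is the identity -/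
  φ_degen : ∀ {N : ℕ} (r : Fin (N + 1)) (a : O.obj (N + 1)) (x : Fin N → A),
    IsIdentity (φ (fun i => (degen r i : ℕ)) (sum_degen r) a (fun i => O.pt (degen r i)) x).hom
  /-- operadic identity: `θ(1; x) = x` -/
  θ_one : ∀ {x x' : A} (l : x ⟶ x'), Arrow.mk ((θ 1).map (𝟙 O.one) (fun _ => l)) = Arrow.mk l
  /-- equivariance of `φ` with respect to permutations of the blocks -/
  φ_act : ∀ {n k : ℕ} {m : Fin n → ℕ} (ρ : Equiv.Perm (Fin n)) (h' : ∑ i, m (ρ i) = k)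
    (h : ∑ i, m i = k) (a : O.obj n) (b : ∀ i, O.obj (m i)) (x : Fin k → A),
    Arrow.mk (φ m h a b x).hom =
    Arrow.mk (φ (fun i => m (ρ i)) h' ((O.act ρ).obj a) (fun i => b (ρ i))
      (fun j => x (blockPerm ρ h' h j))).hom
  /-- equivariance of `φ` with respect to permutations within the blocks -/
  φ_blockSum : ∀ {n k : ℕ} {m : Fin n → ℕ} (h : ∑ i, m i = k) (τ : ∀ i, Equiv.Perm (Fin (m i)))
    (a : O.obj n) (b : ∀ i, O.obj (m i)) (x : Fin k → A),
    Arrow.mk (φ m h a b x).hom =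
    Arrow.mk (φ m h a (fun i => (O.act (τ i)).obj (b i)) (fun j => x (blockSum h τ j))).hom
  /-- operadic identity: `φ` at `(1; a)` is the identity -/
  φ_one_left : ∀ {n : ℕ} (h : ∑ _i : Fin 1, n = n) (a : O.obj n) (x : Fin n → A),
    IsIdentity (φ (fun _ => n) h O.one (fun _ => a) x).hom
  /-- operadic identity: `φ` at `(a; 1, …, 1)` is the identity -/
  φ_one_right : ∀ {n : ℕ} (h : ∑ _i : Fin n, 1 = n) (a : O.obj n) (x : Fin n → A),
    IsIdentity (φ (fun _ => 1) h a (fun _ => O.one) x).hom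
  /-- operadic composition: the two pasting diagrams from `θ(a; θ(b; θ(c; x)))` agree -/
  φ_assoc : ∀ {n M P : ℕ} {m : Fin n → ℕ} {p : Fin M → ℕ} {q : Fin n → ℕ} (hM : ∑ i, m i = M)
    (hP : ∑ j, p j = P) (hq : ∀ i, ∑ s, p (inc hM i s) = q i) (hQ : ∑ i, q i = P)
    (a : O.obj n) (b : ∀ i, O.obj (m i)) (c : ∀ j, O.obj (p j)) (x : Fin P → A),
    Arrow.mk ((φ m hM a b (fun j => (θ (p j)).obj (c j) (fun t => x (inc hP j t)))).hom ≫
      (φ p hP ((O.γ m hM).obj a b) c x).hom) =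
    Arrow.mk ((θ n).map (𝟙 a) (fun i => (φ _ (hq i) (b i) (fun s => c (inc hM i s))
        (fun t => x (inc hQ i t))).hom) ≫
      (φ q hQ a (fun i => (O.γ _ (hq i)).obj (b i) (fun s => c (inc hM i s))) x).hom)

/-- A pseudoalgebra is a (strict) algebra if all transformations `φ` are identities. -/
def PsAlgStr.IsStrict {O : Operad.{w', w}} {A : Type u} [Category.{v} A] (S : PsAlgStr O A) :
    Prop :=
  ∀ {n k : ℕ} (m : Fin n → ℕ) (h : ∑ i, m i = k) (a : O.obj n) (b : ∀ i, O.obj (m i))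
    (x : Fin k → A), IsIdentity (S.φ m h a b x).hom

/-- A pseudomorphism of pseudoalgebras over the operad `O`. -/
@[ext]
structure PsMor {O : Operad.{w', w}} {A B : Type u} [Category.{v} A] [Category.{v} B]
    (S : PsAlgStr O A) (T : PsAlgStr O B) where
  /-- the underlying functor -/
  F : A ⥤ B
  /-- the invertible transformations `θ(a; F x) ≅ F θ(a; x)` -/
  ζ : ∀ {n : ℕ} (a : O.obj n) (x : Fin n → A),
    (T.θ n).obj a (fun i => F.obj (x i)) ≅ F.obj ((S.θ n).obj a x)
  ζ_natural : ∀ {n : ℕ} {a a' : O.obj n} {x x' : Fin n → A} (f : a ⟶ a') (l : ∀ i, x i ⟶ x' i),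
    (T.θ n).map f (fun i => F.map (l i)) ≫ (ζ a' x').hom = (ζ a x).hom ≫ F.map ((S.θ n).map f l)
  /-- `F` preserves the base object -/
  ζ_zero : ∀ x : Fin 0 → A, IsIdentity (ζ O.zero x).hom
  ζ_one : ∀ x : A, IsIdentity (ζ O.one (fun _ => x)).hom
  /-- equivariance -/
  ζ_act : ∀ {n : ℕ} (ρ : Equiv.Perm (Fin n)) (a : O.obj n) (x : Fin n → A),
    Arrow.mk (ζ a x).hom = Arrow.mk (ζ ((O.act ρ).obj a) (fun i => x (ρ i))).hom
  /-- the two pasting diagrams from `θ(a; θ(b; F x))` to `F θ(γ(a; b); x)` agree -/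
  ζ_comp : ∀ {n k : ℕ} (m : Fin n → ℕ) (h : ∑ i, m i = k) (a : O.obj n) (b : ∀ i, O.obj (m i))
    (x : Fin k → A),
    (T.θ n).map (𝟙 a) (fun i => (ζ (b i) (fun s => x (inc h i s))).hom) ≫
      (ζ a (fun i => (S.θ (m i)).obj (b i) (fun s => x (inc h i s)))).hom ≫
      F.map (S.φ m h a b x).hom =
    (T.φ m h a b (fun j => F.obj (x j))).hom ≫ (ζ ((O.γ m h).obj a b) x).hom

end Pseudoalgebras

section Morphisms

theorem IsIdentity.comp {C : Type*} [Category C] {X Y Z : C} {f : X ⟶ Y} {g : Y ⟶ Z}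
    (hf : IsIdentity f) (hg : IsIdentity g) : IsIdentity (f ≫ g) := by
  obtain ⟨rfl, _, h⟩ := (Arrow.mk_eq_mk_iff _ _).1 hf
  obtain ⟨rfl, _, h'⟩ := (Arrow.mk_eq_mk_iff _ _).1 hg
  simp only [eqToHom_refl, Category.comp_id] at h h'
  subst h h'
  simp [IsIdentity]

theorem IsIdentity.map {C D : Type*} [Category C] [Category D] (F : C ⥤ D) {X Y : C} {f : X ⟶ Y}
    (hf : IsIdentity f) : IsIdentity (F.map f) := by
  obtain ⟨rfl, _, h⟩ := (Arrow.mk_eq_mk_iff _ _).1 hf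
  simp only [eqToHom_refl, Category.comp_id] at h
  subst h
  simp [IsIdentity]

theorem arrow_comp_congr {C : Type*} [Category C] {X Y Z X' Y' Z' : C} {f : X ⟶ Y} {g : Y ⟶ Z}
    {f' : X' ⟶ Y'} {g' : Y' ⟶ Z'} (hf : Arrow.mk f = Arrow.mk f') (hg : Arrow.mk g = Arrow.mk g') :
    Arrow.mk (f ≫ g) = Arrow.mk (f' ≫ g') := by
  obtain ⟨rfl, rfl, h⟩ := (Arrow.mk_eq_mk_iff _ _).1 hf
  obtain ⟨_, rfl, h'⟩ := (Arrow.mk_eq_mk_iff _ _).1 hg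
  simp only [eqToHom_refl, Category.comp_id, Category.id_comp] at h h'
  rw [h, h']

theorem arrow_map_congr {C D : Type*} [Category C] [Category D] (F : C ⥤ D) {X Y X' Y' : C}
    {f : X ⟶ Y} {f' : X' ⟶ Y'} (h : Arrow.mk f = Arrow.mk f') :
    Arrow.mk (F.map f) = Arrow.mk (F.map f') := congrArg F.mapArrow.obj h

variable {O : Operad.{w', w}} {A B C : Type u} [Category.{v} A] [Category.{v} B] [Category.{v} C]

/-- A pseudomorphism is a strict map if all transformations `ζ` are identities. -/
def PsMor.IsStrict {S : PsAlgStr O A} {T : PsAlgStr O B} (f : PsMor S T) : Prop :=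
  ∀ {n : ℕ} (a : O.obj n) (x : Fin n → A), IsIdentity (f.ζ a x).hom

theorem PsAlgStr.obj_act (S : PsAlgStr O A) {n : ℕ} (ρ : Equiv.Perm (Fin n)) (a : O.obj n)
    (x : Fin n → A) : (S.θ n).obj ((O.act ρ).obj a) (fun i => x (ρ i)) = (S.θ n).obj a x := by
  have e := congrArg Comma.left (S.θ_act ρ (𝟙 a) (fun i => 𝟙 (x (ρ i))))
  simpa using e

/-- The identity pseudomorphism. -/
@[simps]
def PsMor.id (S : PsAlgStr O A) : PsMor S S where
  F := 𝟭 A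
  ζ {n} a x := Iso.refl ((S.θ n).obj a x)
  ζ_natural f l := (Category.comp_id _).trans (Category.id_comp _).symm
  ζ_zero _ := rfl
  ζ_one _ := rfl
  ζ_act ρ a x := congrArg (fun y => Arrow.mk (𝟙 y)) (S.obj_act ρ a x).symm
  ζ_comp {n k} m h a b x := by
    have e := (S.θ n).map_id a (fun i => (S.θ (m i)).obj (b i) fun s => x (inc h i s))
    simpa using congrArg (· ≫ (S.φ m h a b x).hom) e

/-- The composite of pseudomorphisms. -/
@[simps]
def PsMor.comp {S : PsAlgStr O A} {T : PsAlgStr O B} {U : PsAlgStr O C} (f : PsMor S T)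
    (g : PsMor T U) : PsMor S U where
  F := f.F ⋙ g.F
  ζ a x := g.ζ a (fun i => f.F.obj (x i)) ≪≫ g.F.mapIso (f.ζ a x)
  ζ_natural {n a a' x x'} k l := by
    have h1 := g.ζ_natural k (fun i => f.F.map (l i))
    have h2 := f.ζ_natural k l
    simp only [Iso.trans_hom, Functor.mapIso_hom, Functor.comp_map, Functor.comp_obj,
      Category.assoc, ← Functor.map_comp, ← h2]
    rw [← Category.assoc, h1]
    simp
  ζ_zero x := IsIdentity.comp (g.ζ_zero fun i => f.F.obj (x i)) (IsIdentity.map g.F (f.ζ_zero x))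
  ζ_one x := IsIdentity.comp (g.ζ_one (f.F.obj x)) (IsIdentity.map g.F (f.ζ_one x))
  ζ_act ρ a x := arrow_comp_congr (g.ζ_act ρ a _) (arrow_map_congr g.F (f.ζ_act ρ a x))
  ζ_comp {n k} m h a b x := by
    have hg := g.ζ_comp m h a b (fun j => f.F.obj (x j))
    have hf := congrArg g.F.map (f.ζ_comp m h a b x)
    have hn := g.ζ_natural (𝟙 a) (fun i => (f.ζ (b i) (fun s => x (inc h i s))).hom)
    have hm := (U.θ n).map_comp (𝟙 a) (𝟙 a)
      (fun i => (g.ζ (b i) (fun s => f.F.obj (x (inc h i s)))).hom)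
      (fun i => g.F.map (f.ζ (b i) (fun s => x (inc h i s))).hom)
    simp only [Functor.map_comp, Category.comp_id] at hf hm
    simp only [Iso.trans_hom, Functor.mapIso_hom, Functor.comp_map, Functor.comp_obj,
      Category.assoc]
    rw [hm, Category.assoc, reassoc_of% hn, hf, reassoc_of% hg]

theorem PsMor.IsStrict.id (S : PsAlgStr O A) : (PsMor.id S).IsStrict := fun _ _ => rfl

theorem PsMor.IsStrict.comp {S : PsAlgStr O A} {T : PsAlgStr O B} {U : PsAlgStr O C}
    {f : PsMor S T} {g : PsMor T U} (hf : f.IsStrict) (hg : g.IsStrict) :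
    (f.comp g).IsStrict := fun a x =>
  IsIdentity.comp (hg a _) (IsIdentity.map g.F (hf a x))

/-- The transformation `l` is an algebra 2-cell from `f` to `g`. -/
def IsTwoCell {S : PsAlgStr O A} {T : PsAlgStr O B} (f g : PsMor S T) (l : f.F ⟶ g.F) : Prop :=
  ∀ {n : ℕ} (a : O.obj n) (x : Fin n → A),
    (T.θ n).map (𝟙 a) (fun i => l.app (x i)) ≫ (g.ζ a x).hom =
      (f.ζ a x).hom ≫ l.app ((S.θ n).obj a x)

/-- `r` is a quasi-inverse of `f` in the 2-category of pseudoalgebras, pseudomorphisms and algebra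
2-cells. -/
def IsQuasiInverse {S : PsAlgStr O A} {T : PsAlgStr O B} (f : PsMor S T) (r : PsMor T S) : Prop :=
  ∃ (η : (PsMor.id S).F ≅ (f.comp r).F) (ε : (r.comp f).F ≅ (PsMor.id T).F),
    IsTwoCell (PsMor.id S) (f.comp r) η.hom ∧ IsTwoCell (r.comp f) (PsMor.id T) ε.hom

end Morphisms

section Equivariant

variable {G : Type u} [Group G]

/-- The structure of a pseudoalgebra over the `G`-operad `O` on the `G`-category `A`: the action
functors are `G`-functors and the transformations `φ` are `G`-transformations. -/
structure GPsAlgStr (O : GOperad.{w', w} G) (A : Type u) [Category.{v} A] [GAction G A] extends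
    PsAlgStr O.toOperad A where
  smul_θ : ∀ (g : G) {n : ℕ} {a a' : O.obj n} {x x' : Fin n → A} (f : a ⟶ a')
    (l : ∀ i, x i ⟶ x' i),
    Arrow.mk ((θ n).map ((GAction.act g).map f) (fun i => (GAction.act g).map (l i))) =
    Arrow.mk ((GAction.act g).map ((θ n).map f l))
  smul_φ : ∀ (g : G) {n k : ℕ} (m : Fin n → ℕ) (h : ∑ i, m i = k) (a : O.obj n)
    (b : ∀ i, O.obj (m i)) (x : Fin k → A),
    Arrow.mk (φ m h ((GAction.act g).obj a) (fun i => (GAction.act g).obj (b i))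
      (fun j => (GAction.act g).obj (x j))).hom =
    Arrow.mk ((GAction.act g).map (φ m h a b x).hom)

/-- A (small) pseudoalgebra over the `G`-operad `O` in `G`-categories. -/
structure GPsAlg (O : GOperad.{w', w} G) where
  /-- the underlying category -/
  carrier : Type u
  [cat : Category.{v} carrier]
  [gact : GAction G carrier]
  /-- the pseudoalgebra structure -/
  str : GPsAlgStr O carrier

attribute [instance] GPsAlg.cat GPsAlg.gact

/-- A pseudomorphism of pseudoalgebras in `G`-categories: the underlying functor is a `G`-functor
and the transformations `ζ` are `G`-transformations. -/
@[ext]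
structure GPsMor {O : GOperad.{w', w} G} (A B : GPsAlg.{w', w, v} O) extends
    PsMor A.str.toPsAlgStr B.str.toPsAlgStr where
  smul_F : ∀ g : G, GAction.act g ⋙ F = F ⋙ GAction.act g
  smul_ζ : ∀ (g : G) {n : ℕ} (a : O.obj n) (x : Fin n → A.carrier),
    Arrow.mk (ζ ((GAction.act g).obj a) (fun i => (GAction.act g).obj (x i))).hom =
    Arrow.mk ((GAction.act g).map (ζ a x).hom)

theorem arrow_map_eq {C D : Type*} [Category C] [Category D] {F F' : C ⥤ D} (h : F = F')
    {X Y : C} (f : X ⟶ Y) : Arrow.mk (F.map f) = Arrow.mk (F'.map f) := by rw [h]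

theorem arrow_id_congr {C : Type*} [Category C] {X Y : C} (h : X = Y) :
    Arrow.mk (𝟙 X) = Arrow.mk (𝟙 Y) := by rw [h]

theorem GPsAlgStr.smul_obj {O : GOperad.{w', w} G} {A : Type u} [Category.{v} A] [GAction G A]
    (S : GPsAlgStr O A) (g : G) {n : ℕ} (a : O.obj n) (x : Fin n → A) :
    (S.θ n).obj ((GAction.act g).obj a) (fun i => (GAction.act g).obj (x i)) =
      (GAction.act g).obj ((S.θ n).obj a x) :=
  congrArg Comma.left (S.smul_θ g (𝟙 a) (fun i => 𝟙 (x i)))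

theorem PsMor.smul_ζ_congr {O : Operad.{w', w}} {A B : Type u} [Category.{v} A] [Category.{v} B]
    {S : PsAlgStr O A} {T : PsAlgStr O B} (f : PsMor S T) {n : ℕ} (a : O.obj n)
    {x x' : Fin n → A} (h : x = x') :
    Arrow.mk (f.ζ a x).hom = Arrow.mk (f.ζ a x').hom := by rw [h]

/-- The identity pseudomorphism. -/
def GPsMor.id {O : GOperad.{w', w} G} (A : GPsAlg.{w', w, v} O) : GPsMor A A where
  toPsMor := PsMor.id A.str.toPsAlgStr
  smul_F _ := rfl
  smul_ζ g _ a x := (arrow_id_congr (A.str.smul_obj g a x)).trans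
    (congrArg Arrow.mk ((GAction.act g).map_id _).symm)

/-- The composite of pseudomorphisms. -/
def GPsMor.comp {O : GOperad.{w', w} G} {A B C : GPsAlg.{w', w, v} O} (f : GPsMor A B)
    (f' : GPsMor B C) : GPsMor A C where
  toPsMor := f.toPsMor.comp f'.toPsMor
  smul_F g := by
    rw [PsMor.comp_F, ← Functor.assoc, f.smul_F, Functor.assoc, f'.smul_F, Functor.assoc]
  smul_ζ g n a x := by
    refine (arrow_comp_congr ?_ ?_).trans
      (congrArg Arrow.mk ((GAction.act g).map_comp _ _).symm)
    · refine Eq.trans (f'.toPsMor.smul_ζ_congr _ (funext fun i => ?_)) (f'.smul_ζ g a _)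
      exact Functor.congr_obj (f.smul_F g) (x i)
    · exact (arrow_map_congr f'.F (f.smul_ζ g a x)).trans (arrow_map_eq (f'.smul_F g) _)

/-- The category of pseudoalgebras and pseudomorphisms. -/
instance (O : GOperad.{w', w} G) : Category (GPsAlg.{w', w, v} O) where
  Hom A B := GPsMor A B
  id A := GPsMor.id A
  comp f g := GPsMor.comp f g
  id_comp f := by
    refine GPsMor.ext rfl (heq_of_eq ?_)
    funext n a x
    exact Iso.ext ((congrArg ((f.ζ a x).hom ≫ ·) (f.F.map_id _)).trans (Category.comp_id _))
  comp_id f := by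
    refine GPsMor.ext rfl (heq_of_eq ?_)
    funext n a x
    exact Iso.ext (Category.id_comp (f.ζ a x).hom)
  assoc f g h := by
    refine GPsMor.ext rfl (heq_of_eq ?_)
    funext n a x
    refine Iso.ext ?_
    change (h.ζ a fun i => g.F.obj (f.F.obj (x i))).hom ≫
        h.F.map ((g.ζ a fun i => f.F.obj (x i)).hom ≫ g.F.map (f.ζ a x).hom) =
      ((h.ζ a fun i => g.F.obj (f.F.obj (x i))).hom ≫
        h.F.map (g.ζ a fun i => f.F.obj (x i)).hom) ≫ h.F.map (g.F.map (f.ζ a x).hom)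
    rw [Functor.map_comp, Category.assoc]

/-- A (small) strict algebra over the `G`-operad `O` in `G`-categories. -/
structure GAlg (O : GOperad.{w', w} G) where
  /-- the underlying pseudoalgebra -/
  toGPsAlg : GPsAlg.{w', w, v} O
  isStrict : toGPsAlg.str.IsStrict

/-- The category of strict algebras and strict maps. -/
instance (O : GOperad.{w', w} G) : Category (GAlg.{w', w, v} O) where
  Hom A B := {f : A.toGPsAlg ⟶ B.toGPsAlg // PsMor.IsStrict (GPsMor.toPsMor f)}
  id A := ⟨𝟙 A.toGPsAlg, PsMor.IsStrict.id _⟩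
  comp f g := ⟨f.1 ≫ g.1, PsMor.IsStrict.comp f.2 g.2⟩
  id_comp f := Subtype.ext (Category.id_comp f.1)
  comp_id f := Subtype.ext (Category.comp_id f.1)
  assoc f g h := Subtype.ext (Category.assoc f.1 g.1 h.1)

end Equivariant

section Restriction

universe z' z

theorem ProdFunctor.arrow_map_congr {X : Type*} [Category X] {ι : Type*} {Y : ι → Type*}
    [∀ i, Category (Y i)] {Z : Type*} [Category Z] (T : ProdFunctor X Y Z)
    {a₁ a₂ a₁' a₂' : X} {b₁ b₂ b₁' b₂' : ∀ i, Y i} {f : a₁ ⟶ a₂} {f' : a₁' ⟶ a₂'}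
    {l : ∀ i, b₁ i ⟶ b₂ i} {l' : ∀ i, b₁' i ⟶ b₂' i} (hf : Arrow.mk f = Arrow.mk f')
    (hl : ∀ i, Arrow.mk (l i) = Arrow.mk (l' i)) :
    Arrow.mk (T.map f l) = Arrow.mk (T.map f' l') := by
  have h1 : b₁ = b₁' := funext fun i => congrArg Comma.left (hl i)
  have h2 : b₂ = b₂' := funext fun i => congrArg Comma.right (hl i)
  have h3 : a₁ = a₁' := congrArg Comma.left hf
  have h4 : a₂ = a₂' := congrArg Comma.right hf
  subst h1 h2 h3 h4
  have h5 : f = f' := Arrow.mk_injective _ _ hf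
  have h6 : l = l' := funext fun i => Arrow.mk_injective _ _ (hl i)
  rw [h5, h6]

theorem PsAlgStr.arrow_φ_congr {O : Operad.{w', w}} {A : Type u} [Category.{v} A]
    (S : PsAlgStr O A) {n k : ℕ} (m : Fin n → ℕ) (h : ∑ i, m i = k) {a a' : O.obj n}
    {b b' : ∀ i, O.obj (m i)} {x x' : Fin k → A} (ha : a = a') (hb : ∀ i, b i = b' i)
    (hx : ∀ j, x j = x' j) :
    Arrow.mk (S.φ m h a b x).hom = Arrow.mk (S.φ m h a' b' x').hom := by
  obtain rfl := ha
  obtain rfl := funext hb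
  obtain rfl := funext hx
  rfl

theorem PsMor.arrow_ζ_congr {O : Operad.{w', w}} {A B : Type u} [Category.{v} A] [Category.{v} B]
    {S : PsAlgStr O A} {T : PsAlgStr O B} (f : PsMor S T) {n : ℕ} {a a' : O.obj n}
    {x x' : Fin n → A} (ha : a = a') (hx : ∀ i, x i = x' i) :
    Arrow.mk (f.ζ a x).hom = Arrow.mk (f.ζ a' x').hom := by
  obtain rfl := ha
  obtain rfl := funext hx
  rfl

theorem isIdentity_of_arrow_eq {C : Type*} [Category C] {X Y X' Y' : C} {f : X ⟶ Y} {g : X' ⟶ Y'}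
    (h : Arrow.mk f = Arrow.mk g) (hg : IsIdentity g) : IsIdentity f := by
  obtain ⟨rfl, rfl, rfl⟩ := (Arrow.mk_eq_mk_iff _ _).1 h
  simpa using hg

theorem arrow_trans_eqToIso {C : Type*} [Category C] {X Y Z : C} (i : X ≅ Y) (h : Y = Z) :
    Arrow.mk (i ≪≫ eqToIso h).hom = Arrow.mk i.hom := by subst h; simp

variable {G : Type u} [Group G]

/-- A map of `G`-operads. -/
structure GOperadHom (O : GOperad.{w', w} G) (O' : GOperad.{z', z} G) where
  /-- the underlying functors -/
  map : ∀ n, O.obj n ⥤ O'.obj n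
  map_act : ∀ {n : ℕ} (σ : Equiv.Perm (Fin n)), O.act σ ⋙ map n = map n ⋙ O'.act σ
  map_one : (map 1).obj O.one = O'.one
  map_γ : ∀ {n k : ℕ} (m : Fin n → ℕ) (h : ∑ i, m i = k) {a a' : O.obj n}
    {b b' : ∀ i, O.obj (m i)} (f : a ⟶ a') (l : ∀ i, b i ⟶ b' i),
    Arrow.mk ((map k).map ((O.γ m h).map f l)) =
    Arrow.mk ((O'.γ m h).map ((map n).map f) (fun i => (map (m i)).map (l i)))
  map_gact : ∀ (g : G) (n : ℕ), GAction.act g ⋙ map n = map n ⋙ GAction.act g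

variable {O : GOperad.{w', w} G} {O' : GOperad.{z', z} G} (j : GOperadHom O O')

namespace GOperadHom

theorem map_γ_obj {n k : ℕ} (m : Fin n → ℕ) (h : ∑ i, m i = k) (a : O.obj n)
    (b : ∀ i, O.obj (m i)) : (j.map k).obj ((O.γ m h).obj a b) =
      (O'.γ m h).obj ((j.map n).obj a) (fun i => (j.map (m i)).obj (b i)) :=
  congrArg Comma.left (j.map_γ m h (𝟙 a) (fun i => 𝟙 (b i)))

theorem map_pt : ∀ i : Fin 2, (j.map i).obj (O.pt i) = O'.pt i
  | 0 => O'.eq_zero _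
  | 1 => j.map_one

/-- Restriction of pseudoalgebra structures along a map of operads. -/
def resStr {A : Type u} [Category.{v} A] (S : PsAlgStr O'.toOperad A) :
    PsAlgStr O.toOperad A where
  θ n :=
    { obj := fun a x => (S.θ n).obj ((j.map n).obj a) x
      map := fun f l => (S.θ n).map ((j.map n).map f) l
      map_id := fun a b => by rw [CategoryTheory.Functor.map_id]; exact (S.θ n).map_id _ _
      map_comp := fun f f' g g' => by rw [Functor.map_comp]; exact (S.θ n).map_comp _ _ _ _ }
  φ {n k} m h a b x := S.φ m h ((j.map n).obj a) (fun i => (j.map (m i)).obj (b i)) x ≪≫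
    eqToIso (congrArg (fun c => (S.θ k).obj c x) (j.map_γ_obj m h a b).symm)
  φ_natural {n k} m h a a' b b' x x' f g l := by
    have h1 := S.φ_natural m h ((j.map n).map f) (fun i => (j.map (m i)).map (g i)) l
    obtain ⟨_, _, e⟩ := (Arrow.mk_eq_mk_iff _ _).1
      ((S.θ k).arrow_map_congr (l := l) (l' := l) (j.map_γ m h f g) (fun _ => rfl))
    simp only [Iso.trans_hom, eqToIso.hom, Category.assoc, e, reassoc_of% h1, eqToHom_trans_assoc,
      eqToHom_refl, Category.id_comp]
  θ_act ρ a a' x x' f l := ((S.θ _).arrow_map_congr (arrow_map_eq (j.map_act ρ) f)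
    (fun _ => rfl)).trans (S.θ_act ρ _ l)
  φ_degen r a x := by
    refine isIdentity_of_arrow_eq (Eq.trans (arrow_trans_eqToIso _ _) ?_)
      (S.φ_degen r ((j.map _).obj a) x)
    exact S.arrow_φ_congr _ _ rfl (fun i => j.map_pt _) (fun _ => rfl)
  θ_one l := by
    refine Eq.trans ((S.θ 1).arrow_map_congr ?_ fun _ => rfl) (S.θ_one l)
    rw [CategoryTheory.Functor.map_id]
    exact arrow_id_congr j.map_one
  φ_act ρ h' h a b x := by
    refine (arrow_trans_eqToIso _ _).trans
      (Eq.trans ?_ (arrow_trans_eqToIso _ _).symm)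
    exact (S.φ_act ρ h' h _ _ x).trans
      (S.arrow_φ_congr _ _ (Functor.congr_obj (j.map_act ρ) a).symm (fun _ => rfl) fun _ => rfl)
  φ_blockSum h τ a b x := by
    refine (arrow_trans_eqToIso _ _).trans
      (Eq.trans ?_ (arrow_trans_eqToIso _ _).symm)
    exact (S.φ_blockSum h τ _ _ x).trans
      (S.arrow_φ_congr _ _ rfl (fun i => (Functor.congr_obj (j.map_act (τ i)) (b i)).symm)
        fun _ => rfl)
  φ_one_left h a x :=
    isIdentity_of_arrow_eq ((arrow_trans_eqToIso _ _).trans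
      (S.arrow_φ_congr _ _ j.map_one (fun _ => rfl) fun _ => rfl)) (S.φ_one_left h _ x)
  φ_one_right h a x :=
    isIdentity_of_arrow_eq ((arrow_trans_eqToIso _ _).trans
      (S.arrow_φ_congr _ _ rfl (fun _ => j.map_one) fun _ => rfl)) (S.φ_one_right h _ x)
  φ_assoc {n M P m p q} hM hP hq hQ a b c x := by
    refine Eq.trans (arrow_comp_congr (arrow_trans_eqToIso _ _)
      ((arrow_trans_eqToIso _ _).trans
        (S.arrow_φ_congr _ _ (j.map_γ_obj m hM a b) (fun _ => rfl) fun _ => rfl))) ?_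
    refine Eq.trans (S.φ_assoc hM hP hq hQ _ _ _ x) ?_
    refine (arrow_comp_congr ?_ ((arrow_trans_eqToIso _ _).trans
        (S.arrow_φ_congr _ _ rfl (fun i => j.map_γ_obj _ (hq i) (b i) _) fun _ => rfl))).symm
    exact (S.θ n).arrow_map_congr (congrArg Arrow.mk ((j.map n).map_id a))
      (fun i => arrow_trans_eqToIso _ _)

theorem resStr_isStrict {A : Type u} [Category.{v} A] {S : PsAlgStr O'.toOperad A}
    (hS : S.IsStrict) : (j.resStr S).IsStrict := fun m h _ _ x =>
  isIdentity_of_arrow_eq (arrow_trans_eqToIso _ _) (hS m h _ _ x)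

/-- Restriction of pseudomorphisms along a map of operads. -/
def resMor {A B : Type u} [Category.{v} A] [Category.{v} B] {S : PsAlgStr O'.toOperad A}
    {T : PsAlgStr O'.toOperad B} (f : PsMor S T) : PsMor (j.resStr S) (j.resStr T) where
  F := f.F
  ζ {n} a x := f.ζ ((j.map n).obj a) x
  ζ_natural {n} _ _ _ _ k l := f.ζ_natural ((j.map n).map k) l
  ζ_zero x := isIdentity_of_arrow_eq (f.arrow_ζ_congr (O'.eq_zero _) fun _ => rfl) (f.ζ_zero x)
  ζ_one x := isIdentity_of_arrow_eq (f.arrow_ζ_congr j.map_one fun _ => rfl) (f.ζ_one x)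
  ζ_act ρ a x := (f.ζ_act ρ _ x).trans
    (f.arrow_ζ_congr (Functor.congr_obj (j.map_act ρ) a).symm fun _ => rfl)
  ζ_comp {n k} m h a b x := by
    have h1 := f.ζ_comp m h ((j.map n).obj a) (fun i => (j.map (m i)).obj (b i)) x
    have h2 : ∀ (c c' : O'.obj k) (hc : c = c'),
        (f.ζ c x).hom ≫ f.F.map (eqToHom (congrArg (fun c => (S.θ k).obj c x) hc)) =
        eqToHom (congrArg (fun c => (T.θ k).obj c fun i => f.F.obj (x i)) hc) ≫ (f.ζ c' x).hom := by
      rintro c _ rfl; simp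
    have h3 := h2 _ _ (j.map_γ_obj m h a b).symm
    simp only [resStr, Iso.trans_hom, eqToIso.hom, Functor.map_comp, CategoryTheory.Functor.map_id,
      Category.assoc]
    rw [← h3, ← reassoc_of% h1]

/-- Restriction of pseudoalgebras along a map of `G`-operads. -/
def resObj (A : GPsAlg.{z', z, v} O') : GPsAlg.{w', w, v} O where
  carrier := A.carrier
  str :=
    { toPsAlgStr := j.resStr A.str.toPsAlgStr
      smul_θ := fun g n a a' x x' f l => by
        refine Eq.trans ?_ (A.str.smul_θ g ((j.map n).map f) l)
        exact (A.str.θ n).arrow_map_congr (arrow_map_eq (j.map_gact g n) f) (fun _ => rfl)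
      smul_φ := fun g n k m h a b x => by
        refine (arrow_trans_eqToIso _ _).trans ?_
        refine Eq.trans ?_ (arrow_map_congr (GAction.act g)
          (arrow_trans_eqToIso (A.str.φ m h _ _ x) _)).symm
        refine Eq.trans ?_ (A.str.smul_φ g m h _ _ x)
        exact A.str.arrow_φ_congr _ _ (Functor.congr_obj (j.map_gact g n) a)
          (fun i => Functor.congr_obj (j.map_gact g (m i)) (b i)) fun _ => rfl }

/-- Restriction along a map of `G`-operads, as a functor between categories of pseudoalgebras and
pseudomorphisms. -/
def res : GPsAlg.{z', z, v} O' ⥤ GPsAlg.{w', w, v} O where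
  obj A := j.resObj A
  map {A B} f :=
    { toPsMor := j.resMor (GPsMor.toPsMor f)
      smul_F := fun g => GPsMor.smul_F f g
      smul_ζ := fun g n a x => by
        refine Eq.trans ?_ (GPsMor.smul_ζ f g ((j.map n).obj a) x)
        exact (GPsMor.toPsMor f).arrow_ζ_congr (Functor.congr_obj (j.map_gact g n) a) fun _ => rfl }
  map_id _ := rfl
  map_comp _ _ := rfl

/-- Restriction along a map of `G`-operads, as a functor between categories of strict algebras and
strict maps. -/
def resStrict : GAlg.{z', z, v} O' ⥤ GAlg.{w', w, v} O where
  obj A := ⟨j.res.obj A.toGPsAlg, j.resStr_isStrict A.isStrict⟩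
  map f := ⟨j.res.map f.1, fun a x => f.2 ((j.map _).obj a) x⟩
  map_id _ := rfl
  map_comp _ _ := rfl

end GOperadHom

end Restriction

section Permutativity

/-- The functor `Cat(E, X) × ∏ i, Cat(E, Y i) ≅ Cat(E, X × ∏ i, Y i) ⥤ Cat(E, Z)` induced by
`T : X × ∏ i, Y i ⥤ Z`. -/
@[simps]
def ProdFunctor.cat (E : Type*) [Category E] {X : Type*} [Category X] {ι : Type*} {Y : ι → Type*}
    [∀ i, Category (Y i)] {Z : Type*} [Category Z] (T : ProdFunctor X Y Z) :
    ProdFunctor (E ⥤ X) (fun i => E ⥤ Y i) (E ⥤ Z) where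
  obj a b :=
    { obj := fun e => T.obj (a.obj e) (fun i => (b i).obj e)
      map := fun k => T.map (a.map k) (fun i => (b i).map k)
      map_id := fun e => by
        simp only [CategoryTheory.Functor.map_id]
        exact T.map_id _ _
      map_comp := fun k l => by
        simp only [Functor.map_comp]
        exact T.map_comp _ _ _ _ }
  map f l :=
    { app := fun e => T.map (f.app e) (fun i => (l i).app e)
      naturality := fun e e' k => by
        simp only [← T.map_comp, NatTrans.naturality] }
  map_id a b := by
    ext e
    exact T.map_id _ _
  map_comp f f' g g' := by
    ext e
    exact T.map_comp _ _ _ _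

variable (G : Type u) [Group G]

/-- The chaotic category `ℰG` on the set `G`. -/
abbrev EG := Codiscrete G

/-- The left action of `G` on `ℰG` by left multiplication. -/
instance : GAction G (EG G) where
  act g := Codiscrete.functorOfFun (g * ·)
  act_one := by
    refine CategoryTheory.Functor.ext (fun x => ?_) (fun _ _ _ => rfl)
    exact Codiscrete.ext (one_mul x.as)
  act_mul g h := by
    refine CategoryTheory.Functor.ext (fun x => ?_) (fun _ _ _ => rfl)
    exact Codiscrete.ext (mul_assoc g h x.as)

variable {G} in
/-- The conjugation action of `G` on `Cat(ℰG, A)`. -/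
instance {A : Type*} [Category A] [GAction G A] : GAction G (EG G ⥤ A) where
  act g := (Functor.whiskeringLeft _ _ _).obj (GAction.act g⁻¹) ⋙
    (Functor.whiskeringRight _ _ _).obj (GAction.act g)
  act_one := by
    rw [inv_one, GAction.act_one, GAction.act_one]
    rfl
  act_mul g h := by
    rw [mul_inv_rev, GAction.act_mul, GAction.act_mul]
    rfl

theorem Codiscrete.arrow_ext {X : Type*} {a b a' b' : Codiscrete X} (f : a ⟶ b) (f' : a' ⟶ b')
    (h : a = a') (h' : b = b') : Arrow.mk f = Arrow.mk f' := by
  subst h h'; rfl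

theorem Codiscrete.functor_ext {C X : Type*} [Category C] {F F' : C ⥤ Codiscrete X}
    (h : ∀ c, F.obj c = F'.obj c) : F = F' :=
  CategoryTheory.Functor.ext h fun _ _ _ => rfl

theorem Codiscrete.arrow_functor_ext {C X : Type*} [Category C] {F H F' H' : C ⥤ Codiscrete X}
    (α : F ⟶ H) (α' : F' ⟶ H') (h : ∀ c, Arrow.mk (α.app c) = Arrow.mk (α'.app c)) :
    Arrow.mk α = Arrow.mk α' := by
  obtain rfl : F = F' := functor_ext fun c => congrArg Comma.left (h c)
  obtain rfl : H = H' := functor_ext fun c => congrArg Comma.right (h c)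
  exact congrArg Arrow.mk (NatTrans.ext (funext fun _ => rfl))

/-- The permutativity operad `𝒫`, with `𝒫(n)` the chaotic category on the symmetric group, and with
trivial action of `G`. -/
def permOperad : GOperad.{0, 0} G where
  obj n := Codiscrete (Equiv.Perm (Fin n))
  act σ := Codiscrete.functorOfFun (· * σ)
  act_one := Codiscrete.functor_ext fun a => Codiscrete.ext (mul_one a.as)
  act_mul σ τ := Codiscrete.functor_ext fun a => Codiscrete.ext (mul_assoc a.as σ τ).symm
  zero := ⟨1⟩
  eq_zero a := Codiscrete.ext (Subsingleton.elim _ _)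
  hom_zero _ := rfl
  one := ⟨1⟩
  γ m h :=
    { obj := fun a b => ⟨assocComp h a.as (fun i => (b i).as)⟩
      map := fun _ _ => ()
      map_id := fun _ _ => rfl
      map_comp := fun _ _ _ _ => rfl }
  one_γ h a a' f := Codiscrete.arrow_ext _ _
    (congrArg Codiscrete.mk (assocComp_one_left h a.as))
    (congrArg Codiscrete.mk (assocComp_one_left h a'.as))
  γ_one h a a' f := Codiscrete.arrow_ext _ _
    (congrArg Codiscrete.mk (assocComp_one_right h a.as))
    (congrArg Codiscrete.mk (assocComp_one_right h a'.as))
  γ_assoc hM hP hq hQ a a' b b' c c' f g l := Codiscrete.arrow_ext _ _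
    (congrArg Codiscrete.mk (assocComp_assoc hM hP hq hQ a.as (fun i => (b i).as) fun j => (c j).as))
    (congrArg Codiscrete.mk (assocComp_assoc hM hP hq hQ a'.as (fun i => (b' i).as) fun j => (c' j).as))
  γ_act {n k m} σ h' h a a' b b' f g := Codiscrete.arrow_ext _ _
    (congrArg Codiscrete.mk (assocComp_act (fun σ => (Equiv.sum_comp σ m).trans h) h σ a.as
      fun i => (b i).as))
    (congrArg Codiscrete.mk (assocComp_act (fun σ => (Equiv.sum_comp σ m).trans h) h σ a'.as
      fun i => (b' i).as))
  γ_blockSum h τ a a' b b' f g := Codiscrete.arrow_ext _ _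
    (congrArg Codiscrete.mk (assocComp_blockSum h a.as (fun i => (b i).as) τ))
    (congrArg Codiscrete.mk (assocComp_blockSum h a'.as (fun i => (b' i).as) τ))
  gact n :=
    { act := fun _ => 𝟭 _
      act_one := rfl
      act_mul := fun _ _ => rfl }
  gact_act _ _ _ := rfl
  gact_one _ := rfl
  gact_γ _ _ _ _ _ _ _ _ _ _ _ := rfl

/-- The permutativity operad `𝒫_G = Cat(ℰG, 𝒫)`, with the operad structure induced from that of `𝒫`
and with `G` acting by conjugation. -/
def permOperadG : GOperad.{u, u} G where
  obj n := EG G ⥤ (permOperad G).obj n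
  act σ := (Functor.whiskeringRight _ _ _).obj ((permOperad G).act σ)
  act_one := by intro n; rw [(permOperad G).act_one]; rfl
  act_mul σ τ := by rw [(permOperad G).act_mul]; rfl
  zero := (Functor.const _).obj (permOperad G).zero
  eq_zero a := Codiscrete.functor_ext fun _ => (permOperad G).eq_zero _
  hom_zero _ := NatTrans.ext (funext fun _ => rfl)
  one := (Functor.const _).obj (permOperad G).one
  γ m h := ((permOperad G).γ m h).cat (EG G)
  one_γ h _ _ f := Codiscrete.arrow_functor_ext _ _ fun e => (permOperad G).one_γ h (f.app e)
  γ_one h _ _ f := Codiscrete.arrow_functor_ext _ _ fun e => (permOperad G).γ_one h (f.app e)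
  γ_assoc hM hP hq hQ _ _ _ _ _ _ f g l := Codiscrete.arrow_functor_ext _ _ fun e =>
    (permOperad G).γ_assoc hM hP hq hQ (f.app e) (fun i => (g i).app e) fun j => (l j).app e
  γ_act σ h' h _ _ _ _ f g := Codiscrete.arrow_functor_ext _ _ fun e =>
    (permOperad G).γ_act σ h' h (f.app e) fun i => (g i).app e
  γ_blockSum h τ _ _ _ _ f g := Codiscrete.arrow_functor_ext _ _ fun e =>
    (permOperad G).γ_blockSum h τ (f.app e) fun i => (g i).app e
  gact n := inferInstance
  gact_act _ _ _ := rfl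
  gact_one _ := rfl
  gact_γ _ _ _ _ _ _ _ _ _ _ _ := rfl

/-- The map of `G`-operads `ι : 𝒫 → 𝒫_G` induced by `ℰG → *`. -/
def permOperadι : GOperadHom (permOperad G) (permOperadG G) where
  map n := Functor.const (EG G)
  map_act _ := rfl
  map_one := rfl
  map_γ _ _ _ _ _ _ _ _ := rfl
  map_gact _ _ := rfl

/-- Naive symmetric monoidal `G`-categories and strong symmetric monoidal `G`-functors. -/
abbrev NaiveSymMon := GPsAlg.{0, 0, u} (permOperad G)

/-- Genuine symmetric monoidal `G`-categories and strong symmetric monoidal `G`-functors. -/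
abbrev GenuineSymMon := GPsAlg.{u, u, u} (permOperadG G)

/-- Naive permutative `G`-categories. -/
abbrev NaivePerm := GAlg.{0, 0, u} (permOperad G)

/-- Genuine permutative `G`-categories. -/
abbrev GenuinePerm := GAlg.{u, u, u} (permOperadG G)

variable {G}

/-- The genuine symmetric monoidal `G`-category given by a structure on `Cat(ℰG, A)`. -/
abbrev GenuineSymMon.of {A : NaiveSymMon G} (S : GPsAlgStr (permOperadG G) (EG G ⥤ A.carrier)) :
    GenuineSymMon G where
  carrier := EG G ⥤ A.carrier
  str := S

/-- The functor from naive to genuine symmetric monoidal `G`-categories with the given values. -/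
@[simps]
def symMonFunctor
    (S : ∀ A : NaiveSymMon G, GPsAlgStr (permOperadG G) (EG G ⥤ A.carrier))
    (M : ∀ {A B : NaiveSymMon G} (_ : A ⟶ B), GenuineSymMon.of (S A) ⟶ GenuineSymMon.of (S B))
    (hid : ∀ A : NaiveSymMon G, M (𝟙 A) = 𝟙 _)
    (hcomp : ∀ {A B C : NaiveSymMon G} (f : A ⟶ B) (f' : B ⟶ C), M (f ≫ f') = M f ≫ M f') :
    NaiveSymMon G ⥤ GenuineSymMon G where
  obj A := GenuineSymMon.of (S A)
  map f := M f
  map_id A := hid A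
  map_comp f f' := hcomp f f'

/-- The functor from naive to genuine permutative `G`-categories with the given values. -/
@[simps]
def permFunctor
    (S : ∀ A : NaiveSymMon G, GPsAlgStr (permOperadG G) (EG G ⥤ A.carrier))
    (M : ∀ {A B : NaiveSymMon G} (_ : A ⟶ B), GenuineSymMon.of (S A) ⟶ GenuineSymMon.of (S B))
    (hid : ∀ A : NaiveSymMon G, M (𝟙 A) = 𝟙 _)
    (hcomp : ∀ {A B C : NaiveSymMon G} (f : A ⟶ B) (f' : B ⟶ C), M (f ≫ f') = M f ≫ M f')
    (hS : ∀ A : NaiveSymMon G, A.str.IsStrict → (S A).IsStrict)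
    (hM : ∀ {A B : NaiveSymMon G} (f : A ⟶ B),
      (GPsMor.toPsMor f).IsStrict → (GPsMor.toPsMor (M f)).IsStrict) :
    NaivePerm G ⥤ GenuinePerm G where
  obj A := ⟨GenuineSymMon.of (S A.toGPsAlg), hS A.toGPsAlg A.isStrict⟩
  map f := ⟨M f.1, hM f.1 f.2⟩
  map_id A := Subtype.ext (hid A.toGPsAlg)
  map_comp f f' := Subtype.ext (hcomp f.1 f'.1)

/-- A morphism of naive symmetric monoidal `G`-categories is a naive equivalence if, after the
action of `G` is forgotten, it is an equivalence of `𝒫`-pseudoalgebras. -/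
def IsNaiveEquivalence {A B : NaiveSymMon G} (f : A ⟶ B) : Prop :=
  ∃ r : PsMor B.str.toPsAlgStr A.str.toPsAlgStr, IsQuasiInverse (GPsMor.toPsMor f) r

/-- A morphism of naive permutative `G`-categories is a naive equivalence if, after the action of
`G` is forgotten, it is an equivalence of `𝒫`-algebras and strict maps. -/
def IsStrictNaiveEquivalence {A B : NaivePerm G} (f : A ⟶ B) : Prop :=
  ∃ r : PsMor B.toGPsAlg.str.toPsAlgStr A.toGPsAlg.str.toPsAlgStr,
    r.IsStrict ∧ IsQuasiInverse (GPsMor.toPsMor f.1) r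

end Permutativity

end OperadicGCat

open OperadicGCat

/-! The functor `Cat(ℰG, -)` preserves products, and both `𝒫_G` and its composition are obtained
from `𝒫` by applying it. Every axiom for the structure on `Cat(ℰG, A)` therefore becomes, at each
object `e` of `ℰG`, the same axiom for `A` at the values of the operations and variables at `e`. For
the group, `(g x)(e) = g (x (g⁻¹ e))`, so equivariance at `e` is equivariance in `A` at `g⁻¹ e`. A
transformation with identity components is an identity, so strict algebras and strict maps are
preserved.

What needs care is that an equation between transformations also asserts that their source functors
and their target functors agree, on the morphisms of `ℰG` as well as on objects. The axioms for `θ`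
are equations between morphisms and give this at once. The axioms for `φ` and `ζ` speak of objects
only. But `φ` and `ζ` are invertible, and a transformation with monic components determines its
source functor from its target functor and its components. This is `arrow_natTrans_ext_of_mono`; the
target functors are built from `θ`, `γ` and underlying functors alone, and are compared by the
axioms for these.

For the equivalence, evaluation at `1` is a strict map of `𝒫`-structures and a retraction of `ι`.
The unique morphism `1 ⟶ e` of `ℰG` gives an isomorphism `x(1) ≅ x(e)`, natural in `x` and `e`, from
the constant functor at `x(1)` to `x`. It is an algebra 2-cell over `𝒫`, because the operations
coming from `𝒫` are constant and send `1 ⟶ e` to an identity. Evaluation at `1` need not commute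
with `G`, so the equivalence is only naive. As all the maps involved are strict, the same data serve
the permutative case. -/

namespace OperadicGCat

/-! ### Equality of functors and of transformations, tested on arrows. -/

section FunctorCategories

variable {E C : Type*} [Category E] [Category C]

theorem functor_ext_arrow {F F' : E ⥤ C}
    (h : ∀ {e e' : E} (k : e ⟶ e'), Arrow.mk (F.map k) = Arrow.mk (F'.map k)) : F = F' :=
  CategoryTheory.Functor.ext (fun e => congrArg Comma.left (h (𝟙 e)))
    fun _ _ k => ((Arrow.mk_eq_mk_iff _ _).1 (h k)).2.2

/-- An arrow of the functor category records its two functors, and agreement of components controls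
these only on objects; hence the separate hypotheses on morphisms. -/
theorem arrow_natTrans_ext {F H F' H' : E ⥤ C} (α : F ⟶ H) (α' : F' ⟶ H')
    (hF : ∀ {e e' : E} (k : e ⟶ e'), Arrow.mk (F.map k) = Arrow.mk (F'.map k))
    (hH : ∀ {e e' : E} (k : e ⟶ e'), Arrow.mk (H.map k) = Arrow.mk (H'.map k))
    (h : ∀ e, Arrow.mk (α.app e) = Arrow.mk (α'.app e)) : Arrow.mk α = Arrow.mk α' := by
  obtain rfl : F = F' := functor_ext_arrow hF
  obtain rfl : H = H' := functor_ext_arrow hH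
  exact congrArg Arrow.mk (NatTrans.ext (funext fun e => Arrow.mk_injective _ _ (h e)))

/-- If the components are monomorphisms, then the source functor is determined by the target
functor. -/
theorem arrow_natTrans_ext_of_mono {F H F' H' : E ⥤ C} (α : F ⟶ H) (α' : F' ⟶ H')
    [∀ e, Mono (α.app e)]
    (hH : ∀ {e e' : E} (k : e ⟶ e'), Arrow.mk (H.map k) = Arrow.mk (H'.map k))
    (h : ∀ e, Arrow.mk (α.app e) = Arrow.mk (α'.app e)) : Arrow.mk α = Arrow.mk α' := by
  refine arrow_natTrans_ext α α' (fun {e e'} k => ?_) hH h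
  obtain rfl : H = H' := functor_ext_arrow hH
  obtain ⟨p, _, q⟩ := (Arrow.mk_eq_mk_iff _ _).1 (h e)
  obtain ⟨p', _, q'⟩ := (Arrow.mk_eq_mk_iff _ _).1 (h e')
  refine (Arrow.mk_eq_mk_iff _ _).2 ⟨p, p', ?_⟩
  -- Naturality expresses `F.map k` followed by `α.app e'` through `H` and the components, which are
  -- shared with `α'` up to `eqToHom`.
  rw [← cancel_mono (α.app e'), α.naturality, q, q']
  simp

theorem arrow_natIso_ext {F H F' H' : E ⥤ C} (α : F ≅ H) (α' : F' ≅ H')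
    (hH : ∀ {e e' : E} (k : e ⟶ e'), Arrow.mk (H.map k) = Arrow.mk (H'.map k))
    (h : ∀ e, Arrow.mk (α.hom.app e) = Arrow.mk (α'.hom.app e)) :
    Arrow.mk α.hom = Arrow.mk α'.hom :=
  arrow_natTrans_ext_of_mono α.hom α'.hom hH h

theorem IsIdentity.mono {X Y : C} {f : X ⟶ Y} (hf : IsIdentity f) : Mono f := by
  obtain ⟨rfl, _, h⟩ := (Arrow.mk_eq_mk_iff _ _).1 hf
  simp only [eqToHom_refl, Category.comp_id] at h
  subst h
  infer_instance

/-- Identities are monic, so comparison with `𝟙 H` also forces the source functor to be `H`. All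
unit axioms and all strictness statements for functor categories pass through this. -/
theorem isIdentity_natTrans {F H : E ⥤ C} (α : F ⟶ H) (h : ∀ e, IsIdentity (α.app e)) :
    IsIdentity α := by
  have := fun e => (h e).mono
  exact arrow_natTrans_ext_of_mono α (𝟙 H) (fun _ => rfl) h

end FunctorCategories

/-! ### The pointwise structures and morphisms on `Cat(ℰG, A)`. -/

section InducedStructure

variable {G : Type u} [Group G]

/-- Both operations are constant functors, but `Operad.pt` is defined by cases, so this holds by
computation only once `i` is known. -/
theorem permOperadG_pt_obj (e : EG G) :
    ∀ i : Fin 2, ((permOperadG G).pt i : EG G ⥤ (permOperad G).obj i).obj e = (permOperad G).pt i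
  | 0 => rfl
  | 1 => rfl

/-- This is `θ_act` for the variables permuted by `ρ`, the form in which they occur in the
equivariance axioms for `φ` and `ζ`; it serves to compare the target functors there. -/
theorem PsAlgStr.arrow_map_eq_act {O : Operad.{w', w}} {A : Type u} [Category.{v} A]
    (S : PsAlgStr O A) {n : ℕ} (ρ : Equiv.Perm (Fin n)) {a a' : O.obj n} {x x' : Fin n → A}
    (f : a ⟶ a') (l : ∀ i, x i ⟶ x' i) :
    Arrow.mk ((S.θ n).map f l) =
      Arrow.mk ((S.θ n).map ((O.act ρ).map f) fun i => l (ρ i)) :=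
  (((S.θ n).arrow_map_congr rfl fun i => by rw [Equiv.apply_symm_apply]).trans
    (S.θ_act ρ f fun i => l (ρ i)).symm :)

/-- The structure on `Cat(ℰG, A)` over `𝒫_G` that is induced pointwise by a structure on `A`
over `𝒫`. -/
def PsAlgStr.cat {A : Type u} [Category.{u} A] (S : PsAlgStr (permOperad G).toOperad A) :
    PsAlgStr (permOperadG G).toOperad (EG G ⥤ A) where
  θ n := (S.θ n).cat (EG G)
  φ {n _} m h (a : EG G ⥤ (permOperad G).obj n) (b : ∀ i, EG G ⥤ (permOperad G).obj (m i)) x :=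
    NatIso.ofComponents
      (fun e => S.φ m h (a.obj e) (fun i => (b i).obj e) fun j => (x j).obj e)
      (fun k => S.φ_natural m h (a.map k) (fun i => (b i).map k) fun j => (x j).map k)
  φ_natural m h _ _ _ _ _ _ f g l :=
    NatTrans.ext (funext fun e =>
      S.φ_natural m h (NatTrans.app f e) (fun i => NatTrans.app (g i) e) fun j => (l j).app e)
  -- One axiom is used three times: on a morphism of `ℰG` for the source functors and for the target
  -- functors, then on the components.
  θ_act {n} ρ (a a' : EG G ⥤ (permOperad G).obj n) x x' f l := arrow_natTrans_ext _ _
    (fun k => S.θ_act ρ (a.map k) fun i => (x i).map k)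
    (fun k => S.θ_act ρ (a'.map k) fun i => (x' i).map k)
    (fun e => S.θ_act ρ (NatTrans.app f e) fun i => (l i).app e)
  φ_degen {N} r (a : EG G ⥤ (permOperad G).obj (N + 1)) x :=
    isIdentity_natTrans _ fun e => isIdentity_of_arrow_eq
      (S.arrow_φ_congr _ _ rfl (fun i => permOperadG_pt_obj e (degen r i)) fun _ => rfl)
      (S.φ_degen r (a.obj e) fun i => (x i).obj e)
  θ_one {x x'} l := arrow_natTrans_ext _ _ (fun k => S.θ_one (x.map k))
    (fun k => S.θ_one (x'.map k)) (fun e => S.θ_one (l.app e))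
  φ_act {n _ m} ρ h' h (a : EG G ⥤ (permOperad G).obj n)
      (b : ∀ i, EG G ⥤ (permOperad G).obj (m i)) x := arrow_natTrans_ext_of_mono _ _
    -- The target functors agree on `k` since equivariance of `θ` moves the block permutation onto
    -- the operation, where `γ_act` absorbs it. The source functors then agree because `φ` is
    -- invertible.
    (fun k => (S.arrow_map_eq_act (blockPerm ρ h' h) (((permOperad G).γ m h).map (a.map k)
        fun i => (b i).map k) fun j => (x j).map k).trans
      ((S.θ _).arrow_map_congr ((permOperad G).γ_act ρ h' h (a.map k) fun i => (b i).map k)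
        fun _ => rfl).symm)
    (fun e => S.φ_act ρ h' h (a.obj e) (fun i => (b i).obj e) fun j => (x j).obj e)
  φ_blockSum {n _ m} h τ (a : EG G ⥤ (permOperad G).obj n)
      (b : ∀ i, EG G ⥤ (permOperad G).obj (m i)) x := arrow_natTrans_ext_of_mono _ _
    (fun k => (S.arrow_map_eq_act (blockSum h τ) (((permOperad G).γ m h).map (a.map k)
        fun i => (b i).map k) fun j => (x j).map k).trans
      ((S.θ _).arrow_map_congr ((permOperad G).γ_blockSum h τ (a.map k) fun i => (b i).map k)
        fun _ => rfl).symm)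
    (fun e => S.φ_blockSum h τ (a.obj e) (fun i => (b i).obj e) fun j => (x j).obj e)
  φ_one_left {n} h (a : EG G ⥤ (permOperad G).obj n) x := isIdentity_natTrans _ fun e =>
    S.φ_one_left h (a.obj e) fun i => (x i).obj e
  φ_one_right {n} h (a : EG G ⥤ (permOperad G).obj n) x := isIdentity_natTrans _ fun e =>
    S.φ_one_right h (a.obj e) fun i => (x i).obj e
  φ_assoc {n _ _ m p _} hM hP hq hQ (a : EG G ⥤ (permOperad G).obj n)
      (b : ∀ i, EG G ⥤ (permOperad G).obj (m i)) (c : ∀ j, EG G ⥤ (permOperad G).obj (p j)) x :=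
    arrow_natTrans_ext_of_mono
      -- The composite is presented as the forward map of a single isomorphism, so that its
      -- components are seen to be monic.
      (NatIso.ofComponents _ _ ≪≫ NatIso.ofComponents _ _).hom _
      (fun k => (S.θ _).arrow_map_congr ((permOperad G).γ_assoc hM hP hq hQ (a.map k)
        (fun i => (b i).map k) fun j => (c j).map k) fun _ => rfl)
      (fun e => S.φ_assoc hM hP hq hQ (a.obj e) (fun i => (b i).obj e)
        (fun j => (c j).obj e) fun j => (x j).obj e)

theorem PsAlgStr.IsStrict.cat {A : Type u} [Category.{u} A]
    {S : PsAlgStr (permOperad G).toOperad A} (hS : S.IsStrict) : S.cat.IsStrict :=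
  fun m h _ _ _ => isIdentity_natTrans _ fun _ => hS m h _ _ _

/-- The structure on `Cat(ℰG, A)` induced pointwise, with its equivariance. -/
def GPsAlgStr.cat {A : Type u} [Category.{u} A] [GAction G A]
    (S : GPsAlgStr (permOperad G) A) : GPsAlgStr (permOperadG G) (EG G ⥤ A) where
  toPsAlgStr := S.toPsAlgStr.cat
  smul_θ g n (a a' : EG G ⥤ (permOperad G).obj n) x x' f l := arrow_natTrans_ext _ _
    -- Under conjugation, the value of `g x` at `k` is `g` applied to the value of `x` at `g⁻¹ k`.
    (fun k => S.smul_θ g (a.map ((GAction.act g⁻¹).map k))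
      fun i => (x i).map ((GAction.act g⁻¹).map k))
    (fun k => S.smul_θ g (a'.map ((GAction.act g⁻¹).map k))
      fun i => (x' i).map ((GAction.act g⁻¹).map k))
    (fun e => S.smul_θ g (NatTrans.app f ((GAction.act g⁻¹).obj e))
      fun i => (l i).app ((GAction.act g⁻¹).obj e))
  smul_φ g n _ m h (a : EG G ⥤ (permOperad G).obj n)
      (b : ∀ i, EG G ⥤ (permOperad G).obj (m i)) x := arrow_natTrans_ext_of_mono _ _
    -- No appeal to equivariance of `γ` is needed: `G` acts on `𝒫` by identity functors.
    (fun k => S.smul_θ g (((permOperad G).γ m h).map (a.map ((GAction.act g⁻¹).map k))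
        fun i => (b i).map ((GAction.act g⁻¹).map k))
      fun i => (x i).map ((GAction.act g⁻¹).map k))
    (fun e => S.smul_φ g m h (a.obj ((GAction.act g⁻¹).obj e))
      (fun i => (b i).obj ((GAction.act g⁻¹).obj e))
      fun j => (x j).obj ((GAction.act g⁻¹).obj e))

/-- The pseudomorphism `Cat(ℰG, f)`, with `ζ` given pointwise. -/
def PsMor.cat {A B : Type u} [Category.{u} A] [Category.{u} B]
    {S : PsAlgStr (permOperad G).toOperad A} {T : PsAlgStr (permOperad G).toOperad B}
    (f : PsMor S T) : PsMor S.cat T.cat where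
  F := (Functor.whiskeringRight (EG G) A B).obj f.F
  ζ {n} (a : EG G ⥤ (permOperad G).obj n) x := NatIso.ofComponents
    (fun e => f.ζ (a.obj e) fun i => (x i).obj e)
    (fun k => f.ζ_natural (a.map k) fun i => (x i).map k)
  ζ_natural k l := NatTrans.ext (funext fun e =>
    f.ζ_natural (NatTrans.app k e) fun i => (l i).app e)
  ζ_zero x := isIdentity_natTrans _ fun e => f.ζ_zero fun i => (x i).obj e
  ζ_one x := isIdentity_natTrans _ fun e => f.ζ_one (x.obj e)
  ζ_act {n} ρ (a : EG G ⥤ (permOperad G).obj n) x := arrow_natTrans_ext_of_mono _ _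
    (fun k => arrow_map_congr f.F (S.arrow_map_eq_act ρ (a.map k) fun i => (x i).map k))
    (fun e => f.ζ_act ρ (a.obj e) fun i => (x i).obj e)
  ζ_comp {n _} m h (a : EG G ⥤ (permOperad G).obj n)
      (b : ∀ i, EG G ⥤ (permOperad G).obj (m i)) x := NatTrans.ext (funext fun e =>
    f.ζ_comp m h (a.obj e) (fun i => (b i).obj e) fun j => (x j).obj e)

theorem PsMor.IsStrict.cat {A B : Type u} [Category.{u} A] [Category.{u} B]
    {S : PsAlgStr (permOperad G).toOperad A} {T : PsAlgStr (permOperad G).toOperad B}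
    {f : PsMor S T} (hf : f.IsStrict) : f.cat.IsStrict :=
  fun {n} (a : EG G ⥤ (permOperad G).obj n) x => isIdentity_natTrans _ fun e =>
    hf (a.obj e) fun i => (x i).obj e

/-- The morphism `Cat(ℰG, f)` of genuine symmetric monoidal `G`-categories. -/
def GPsMor.cat {A B : NaiveSymMon G} (f : GPsMor A B) :
    GPsMor (GenuineSymMon.of A.str.cat) (GenuineSymMon.of B.str.cat) where
  toPsMor := f.toPsMor.cat
  smul_F g := by
    refine functor_ext_arrow fun {x x'} l => arrow_natTrans_ext _ _
      (fun k => ?_) (fun k => ?_) fun e => ?_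
    · exact arrow_map_eq (f.smul_F g) (x.map ((GAction.act g⁻¹).map k))
    · exact arrow_map_eq (f.smul_F g) (x'.map ((GAction.act g⁻¹).map k))
    · exact arrow_map_eq (f.smul_F g) (l.app ((GAction.act g⁻¹).obj e))
  smul_ζ g n (a : EG G ⥤ (permOperad G).obj n) x := arrow_natTrans_ext_of_mono _ _
    (fun k => by
      -- The target of `ζ` is `f.F` applied to an action functor, so `g` is moved out first past `θ`
      -- and then past `f.F`.
      refine Eq.trans (arrow_map_congr f.F (A.str.smul_θ g
        (a.map ((GAction.act g⁻¹).map k))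
        fun i => (x i).map ((GAction.act g⁻¹).map k))) ?_
      exact arrow_map_eq (f.smul_F g) _)
    (fun e => f.smul_ζ g (a.obj ((GAction.act g⁻¹).obj e))
      fun i => (x i).obj ((GAction.act g⁻¹).obj e))

end InducedStructure

/-! ### The map `ι`, its quasi-inverse and its naturality. -/

section Constant

variable {G : Type u} [Group G]

/-- The pseudomorphism `ι : A ⥤ Cat(ℰG, A)`. -/
def constPsMor {A : Type u} [Category.{u} A] (S : PsAlgStr (permOperad G).toOperad A) :
    PsMor S ((permOperadι G).resStr S.cat) where
  F := Functor.const (EG G)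
  -- The source functor sends each `k` to `θ` of identities, which is an identity only by `map_id`;
  -- the two functors are thus not equal by definition, although the components are identities.
  ζ {n} a x := NatIso.ofComponents (fun e => Iso.refl ((S.θ n).obj a x))
    (fun k => (Category.comp_id _).trans (((S.θ n).map_id a x).trans (Category.id_comp _).symm))
  ζ_natural k l := NatTrans.ext (funext fun e =>
    (Category.comp_id _).trans (Category.id_comp _).symm)
  ζ_zero x := isIdentity_natTrans _ fun e => rfl
  ζ_one x := isIdentity_natTrans _ fun e => rfl
  ζ_act ρ a x := arrow_natTrans_ext_of_mono _ _
    (fun k => arrow_id_congr (S.obj_act ρ a x).symm)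
    (fun k => arrow_id_congr (S.obj_act ρ a x).symm)
  ζ_comp m h a b x := NatTrans.ext (funext fun e => by
    have := (PsMor.id S).ζ_comp m h a b x
    refine Eq.trans this ?_
    -- The additional factor is the `eqToIso` in the restricted `φ`, which is an identity here since
    -- `ι` commutes with `γ` by definition.
    exact congrArg (· ≫ _) (Category.comp_id _).symm)

theorem constPsMor_isStrict {A : Type u} [Category.{u} A]
    (S : PsAlgStr (permOperad G).toOperad A) : (constPsMor S).IsStrict :=
  fun _ _ => isIdentity_natTrans _ fun _ => rfl

/-- Evaluation at the identity element of `G`, as a pseudomorphism. -/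
def evalPsMor {A : Type u} [Category.{u} A] (S : PsAlgStr (permOperad G).toOperad A) :
    PsMor ((permOperadι G).resStr S.cat) S where
  F := (evaluation (EG G) A).obj ⟨1⟩
  ζ {n} a x := Iso.refl ((S.θ n).obj a fun i => (x i).obj ⟨1⟩)
  ζ_natural k l := (Category.comp_id _).trans (Category.id_comp _).symm
  ζ_zero x := rfl
  ζ_one x := rfl
  ζ_act ρ a x := arrow_id_congr (S.obj_act ρ a fun i => (x i).obj ⟨1⟩).symm
  ζ_comp m h a b x := by
    have := (PsMor.id S).ζ_comp m h a b fun i => (x i).obj ⟨1⟩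
    refine Eq.trans ?_ this
    refine congrArg (_ ≫ _ ≫ ·) ?_
    exact Category.comp_id _

theorem evalPsMor_isStrict {A : Type u} [Category.{u} A]
    (S : PsAlgStr (permOperad G).toOperad A) : (evalPsMor S).IsStrict :=
  fun _ _ => rfl

/-- A functor on `ℰG` is isomorphic to the constant functor at its value at the identity
element. -/
def constEvalIso (G : Type u) [Group G] (A : Type*) [Category A] :
    (evaluation (EG G) A).obj ⟨1⟩ ⋙ Functor.const (EG G) ≅ 𝟭 (EG G ⥤ A) :=
  NatIso.ofComponents
    (fun x => NatIso.ofComponents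
      -- The image under `x` of the unique isomorphism from `1` to `e`.
      (fun e => x.mapIso ⟨(), (), rfl, rfl⟩)
      (fun k => by
        refine (Category.id_comp _).trans ?_
        -- Following `1 ⟶ e` by `k : e ⟶ e'` gives the unique morphism `1 ⟶ e'`.
        exact (x.map_comp _ k)))
    (fun l => NatTrans.ext (funext fun e => (l.naturality _).symm))

theorem constPsMor_isQuasiInverse {A : Type u} [Category.{u} A]
    (S : PsAlgStr (permOperad G).toOperad A) :
    IsQuasiInverse (constPsMor S) (evalPsMor S) := by
  -- Evaluating a constant functor returns its value, so the unit is an identity.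
  refine ⟨Iso.refl _, constEvalIso G A, fun {n} a x => ?_, fun {n} a x => ?_⟩
  · refine congrArg₂ (· ≫ ·) ((S.θ n).map_id a x) ?_
    exact Category.id_comp (𝟙 _)
  -- At `e`, both sides reduce to `θ` of `𝟙 a` and the images of `1 ⟶ e` under the `x i`, the
  -- constant functor at `a` sending `1 ⟶ e` to `𝟙 a`.
  · refine NatTrans.ext (funext fun e => ?_)
    refine (Category.comp_id _).trans (Eq.symm ?_)
    exact (congrArg (· ≫ _) (Category.id_comp (𝟙 _))).trans (Category.id_comp _)

/-- The morphism `ι : A ⥤ Cat(ℰG, A)` of naive symmetric monoidal `G`-categories. -/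
def constGPsMor (A : NaiveSymMon G) :
    GPsMor A ((permOperadι G).resObj (GenuineSymMon.of A.str.cat)) where
  toPsMor := constPsMor A.str.toPsAlgStr
  smul_F g := functor_ext_arrow fun _ => arrow_natTrans_ext _ _
    (fun _ => congrArg Arrow.mk ((GAction.act g).map_id _).symm)
    (fun _ => congrArg Arrow.mk ((GAction.act g).map_id _).symm) fun _ => rfl
  smul_ζ g _ a x := arrow_natIso_ext _ ((GAction.act g).mapIso ((constPsMor _).ζ a x))
    (fun _ => (arrow_id_congr (A.str.smul_obj g a x)).trans
      (congrArg Arrow.mk ((GAction.act g).map_id _).symm))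
    (fun _ => (arrow_id_congr (A.str.smul_obj g a x)).trans
      (congrArg Arrow.mk ((GAction.act g).map_id _).symm))

/-- Comparing the `ζ` as arrows avoids heterogeneous equality when the underlying functors are not
equal by definition. -/
theorem GPsMor.ext_arrow {O : GOperad.{w', w} G} {A B : GPsAlg.{w', w, v} O} {f f' : GPsMor A B}
    (hF : f.F = f'.F) (hζ : ∀ {n : ℕ} (a : O.obj n) (x : Fin n → A.carrier),
      Arrow.mk (f.ζ a x).hom = Arrow.mk (f'.ζ a x).hom) : f = f' := by
  obtain ⟨⟨F, ζ, _, _, _, _, _⟩, _, _⟩ := f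
  obtain ⟨⟨F', ζ', _, _, _, _, _⟩, _, _⟩ := f'
  obtain rfl : F = F' := hF
  obtain rfl : @ζ = @ζ' := by
    funext n a x
    exact Iso.ext (Arrow.mk_injective _ _ (hζ a x))
  rfl

/-- Since `ι` is strict, in both composites every component of `ζ` is that of `f` composed with an
identity, on the left in one and on the right in the other. -/
theorem constGPsMor_natural {A B : NaiveSymMon G} (f : GPsMor A B) :
    GPsMor.comp f (constGPsMor B) =
      GPsMor.comp (constGPsMor A) ((permOperadι G).res.map f.cat) := by
  refine GPsMor.ext_arrow (functor_ext_arrow fun {x x'} l => arrow_natTrans_ext _ _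
    (fun _ => congrArg Arrow.mk (f.F.map_id x).symm)
    (fun _ => congrArg Arrow.mk (f.F.map_id x').symm) fun _ => rfl) fun {n} a x => ?_
  have hf : ∀ e, ((GPsMor.comp f (constGPsMor B)).ζ a x).hom.app e = (f.ζ a x).hom :=
    fun e => Category.id_comp _
  have hf' : ∀ e, ((GPsMor.comp (constGPsMor A) ((permOperadι G).res.map f.cat)).ζ a x).hom.app e
      = (f.ζ a x).hom := fun e =>
    (congrArg (_ ≫ ·) (f.F.map_id _)).trans (Category.comp_id _)
  exact arrow_natIso_ext _ _ (fun _ => congrArg Arrow.mk (f.F.map_id _).symm)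
    fun e => congrArg Arrow.mk ((hf e).trans (hf' e).symm)

end Constant

end OperadicGCat

/-! ### The proposition. -/

theorem mainTheorem6 (G : Type u) [Group G] :
    ∃ (S : ∀ A : NaiveSymMon G, GPsAlgStr (permOperadG G) (EG G ⥤ A.carrier))
      (M : ∀ {A B : NaiveSymMon G} (_ : A ⟶ B), GenuineSymMon.of (S A) ⟶ GenuineSymMon.of (S B))
      (hid : ∀ A : NaiveSymMon G, M (𝟙 A) = 𝟙 (GenuineSymMon.of (S A)))
      (hcomp : ∀ {A B C : NaiveSymMon G} (f : A ⟶ B) (f' : B ⟶ C), M (f ≫ f') = M f ≫ M f')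
      (hS : ∀ A : NaiveSymMon G, A.str.IsStrict → (S A).IsStrict)
      (hM : ∀ {A B : NaiveSymMon G} (f : A ⟶ B),
        (GPsMor.toPsMor f).IsStrict → (GPsMor.toPsMor (M f)).IsStrict),
      -- the structure on `Cat(ℰG, A)` is induced by that on `A`
      (∀ (A : NaiveSymMon G) (n : ℕ), (S A).θ n = (A.str.θ n).cat (EG G)) ∧
      (∀ (A : NaiveSymMon G) {n k : ℕ} (m : Fin n → ℕ) (h : ∑ i, m i = k)
        (a : EG G ⥤ (permOperad G).obj n) (b : ∀ i, EG G ⥤ (permOperad G).obj (m i))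
        (x : Fin k → (EG G ⥤ A.carrier)) (e : EG G),
        Arrow.mk (((S A).φ m h a b x).hom.app e) =
          Arrow.mk (A.str.φ m h (a.obj e) (fun i => (b i).obj e) (fun j => (x j).obj e)).hom) ∧
      -- the morphism on `Cat(ℰG, A)` is induced by that on `A`
      (∀ {A B : NaiveSymMon G} (f : A ⟶ B), (GPsMor.toPsMor (M f)).F =
        (Functor.whiskeringRight (EG G) A.carrier B.carrier).obj (GPsMor.toPsMor f).F) ∧
      (∀ {A B : NaiveSymMon G} (f : A ⟶ B) {n : ℕ} (a : EG G ⥤ (permOperad G).obj n)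
        (x : Fin n → (EG G ⥤ A.carrier)) (e : EG G),
        Arrow.mk (((GPsMor.toPsMor (M f)).ζ a x).hom.app e) =
          Arrow.mk ((GPsMor.toPsMor f).ζ (a.obj e) (fun i => (x i).obj e)).hom) ∧
      -- permutative `G`-categories
      (∃ ι : 𝟭 (NaivePerm G) ⟶ permFunctor S M hid hcomp hS hM ⋙ (permOperadι G).resStrict,
        ∀ A : NaivePerm G,
          (GPsMor.toPsMor (ι.app A).1).F = Functor.const (EG G) ∧
          IsStrictNaiveEquivalence (ι.app A)) ∧
      -- symmetric monoidal `G`-categories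
      (∃ ι : 𝟭 (NaiveSymMon G) ⟶ symMonFunctor S M hid hcomp ⋙ (permOperadι G).res,
        ∀ A : NaiveSymMon G,
          (GPsMor.toPsMor (ι.app A)).F = Functor.const (EG G) ∧
          (GPsMor.toPsMor (ι.app A)).IsStrict ∧
          IsNaiveEquivalence (ι.app A)) := by
  refine ⟨fun A => A.str.cat, fun f => GPsMor.cat f, fun A => ?_, fun f f' => ?_,
    fun A hA => PsAlgStr.IsStrict.cat hA, fun f hf => PsMor.IsStrict.cat hf,
    fun _ _ => rfl, fun _ _ _ _ _ _ _ _ _ => rfl, fun _ => rfl, fun _ _ _ _ _ => rfl, ?_, ?_⟩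
  -- Whiskering with the identity functor, and below with a composite, agrees by definition with the
  -- identity and with the composite of whiskerings.
  · exact GPsMor.ext rfl (heq_of_eq rfl)
  · exact GPsMor.ext rfl (heq_of_eq rfl)
  -- The permutative case reuses the symmetric monoidal data; what it adds is that `ι` and
  -- evaluation at `1` are strict.
  · refine ⟨⟨fun A => ⟨constGPsMor A.toGPsAlg, constPsMor_isStrict _⟩, fun A B f =>
      Subtype.ext (constGPsMor_natural f.1)⟩, fun A => ⟨rfl, evalPsMor _, ?_, ?_⟩⟩
    · exact evalPsMor_isStrict _
    · exact constPsMor_isQuasiInverse _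
  · refine ⟨⟨fun A => constGPsMor A, fun A B f => constGPsMor_natural f⟩,
      fun A => ⟨rfl, constPsMor_isStrict _, evalPsMor _, constPsMor_isQuasiInverse _⟩⟩
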